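/- **Setting.** Let $\mathcal C$ be an abelian category with a braided monoidal structure with braiding $\Psi$, such that $\otimes$ is additive and exact in each variable, and suppose that $\mathcal C$ has countable coproducts and that $\otimes$ preserves them in each variable. Let $V$ be any object of $\mathcal C$. Associativity constraints are suppressed. **The algebras.** Let $TV=\bigoplus_n V^{\otimes n}$ be the tensor algebra. Put $[0,\Psi]!=\mathrm{id}$ and $$[n,\Psi]=\mathrm{id}+\Psi_{12}+\Psi_{12}\Psi_{23}+\dots+\Psi_{12}\cdots\Psi_{n-1,n},\qquad [n,\Psi]!=(\mathrm{id}\otimes[n-1,\Psi]!)\,[n,\Psi].$$ Let $$B=B_+(V)=TV\Big/\bigoplus_n\ker[n,\Psi]!,\qquad \Lambda=\Lambda(V)=TV/\langle \mathrm{Im}(\mathrm{id}+\Psi)\rangle=\bigoplus_p\Lambda^p ,$$ with products induced by that of $TV$; the product of $\Lambda$ is denoted $\wedge$. Let $\Delta:B\to B\otimes B$ be induced by the coproduct of $TV$, i.e. the algebra map from $TV$ to the braided tensor product algebra $TV\,\underline\otimes\,TV$ with $\Delta v=v\otimes 1+1\otimes v$ on $V$. Let $\varpi:B\to V$ be the projection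 to degree 1. **The bigraded object.** For $p,q\ge 0$ let $\Omega^{p,q}=\Lambda^p\otimes B\otimes\Lambda^q$. Give $\Omega=(\Omega^{p,q})_{p,q}$ the unit $1\otimes1\otimes1$ and the product of the braided super tensor product $\Lambda\,\underline\otimes\, B\,\underline\otimes\,\Lambda$: written on elements, for $\omega\otimes y\in\Lambda^p\otimes(B\otimes\Lambda^q)$ and $\omega'\otimes y'\in\Lambda^{p'}\otimes(B\otimes\Lambda^{q'})$, $$(\omega\otimes y)(\omega'\otimes y')=(-1)^{qp'}\,\omega\,\Psi(y\otimes\omega')\,y',$$ where the product in $B\,\underline\otimes\,\Lambda$ is $(b\otimes\eta)(b'\otimes\eta')=b\,\Psi(\eta\otimes b')\,\eta'$. Set $$\partial=(-1)^p\big((\wedge\otimes\mathrm{id})(\mathrm{id}\otimes\varpi\otimes\mathrm{id})(\mathrm{id}\otimes\Delta)\big)\otimes\mathrm{id}:\Omega^{p,q}\to\Omega^{p+1,q},$$ $$\bar\partial=(-1)^p\,\mathrm{id}\otimes\big((\mathrm{id}\otimes\wedge)(\mathrm{id}\otimes\varpi\otimes\mathrm{id})(\Delta\otimes\mathrm{id})\big):\Omega^{p,q}\to\Omega^{p,q+1},$$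 where $V$ is identified with $\Lambda^1$. **Proposition.** The products of $B$ and $\Lambda$, the coproduct $\Delta$ and the projection $\varpi$ are well defined on the quotients, and $(\Omega^{\bullet,\bullet},\partial,\bar\partial)$ is a double complex. That is, $\Omega$ is an associative unital bigraded algebra; $\partial$ and $\bar\partial$ are graded derivations for the total degree, i.e. $\delta(\xi\zeta)=(\delta\xi)\zeta+(-1)^{p+q}\xi\,\delta\zeta$ for $\xi\in\Omega^{p,q}$ and $\delta\in\{\partial,\bar\partial\}$; and $$\partial^2=0,\qquad \bar\partial^2=0,\qquad \partial\bar\partial+\bar\partial\partial=0 .$$ -/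

import Mathlib

open CategoryTheory CategoryTheory.Limits CategoryTheory.MonoidalCategory

namespace BraidedPlane

noncomputable section

universe v u

/-! ## Tensor powers, braided integers and braided factorials -/

section Powers

variable {C : Type u} [Category.{v} C] [MonoidalCategory C]

/-- The tensor power `V^{⊗n}`, bracketed to the right: `V ⊗ (V ⊗ (⋯ ⊗ 𝟙))`. -/
def tpow (V : C) : ℕ → C
  | 0 => 𝟙_ C
  | n + 1 => V ⊗ tpow V n

/-- `V^{⊗0}` is the unit object (an identity map, recorded to keep the types explicit). -/
def tnil (V : C) : 𝟙_ C ≅ tpow V 0 := Iso.refl _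

/-- `V^{⊗(n+1)}` is `V ⊗ V^{⊗n}` (an identity map, recorded to keep the types explicit). -/
def tcons (V : C) (n : ℕ) : V ⊗ tpow V n ≅ tpow V (n + 1) := Iso.refl _

/-- The identification of `V` with `V^{⊗1}`. -/
def tone (V : C) : V ≅ tpow V 1 := (ρ_ V).symm ≪≫ whiskerLeftIso V (tnil V) ≪≫ tcons V 0

/-- `id_V ⊗ f` on `V^{⊗(n+1)}`, for `f` on `V^{⊗n}`. -/
def tail (V : C) {n : ℕ} (f : tpow V n ⟶ tpow V n) : tpow V (n + 1) ⟶ tpow V (n + 1) :=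
  (tcons V n).inv ≫ V ◁ f ≫ (tcons V n).hom

/-- Concatenation `V^{⊗m} ⊗ V^{⊗n} ≅ V^{⊗k}` for `k = m + n`: the product of the tensor algebra. -/
def tmul (V : C) : (m n k : ℕ) → m + n = k → (tpow V m ⊗ tpow V n ⟶ tpow V k)
  | 0, n, k, h => (tnil V).inv ▷ tpow V n ≫ (λ_ (tpow V n)).hom ≫ eqToHom (by rw [← h, Nat.zero_add])
  | m + 1, n, 0, h => absurd h (by omega)
  | m + 1, n, k + 1, h =>
      (tcons V m).inv ▷ tpow V n ≫ (α_ V (tpow V m) (tpow V n)).hom ≫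
        V ◁ tmul V m n k (by omega) ≫ (tcons V k).hom

variable [BraidedCategory C]

/-- The braiding acting on the first two tensor factors of `V^{⊗(n+2)}`. -/
def braidFirst (V : C) (n : ℕ) : tpow V (n + 2) ⟶ tpow V (n + 2) :=
  (tcons V (n + 1)).inv ≫ V ◁ (tcons V n).inv ≫ (α_ V V (tpow V n)).inv ≫
    (β_ V V).hom ▷ tpow V n ≫
    (α_ V V (tpow V n)).hom ≫ V ◁ (tcons V n).hom ≫ (tcons V (n + 1)).hom

/-- The braiding `Ψ_{i+1,i+2}` acting on the adjacent tensor factors `i+1, i+2` of `V^{⊗n}`.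
It is only used for `i + 2 ≤ n`; it is set to `0` otherwise. -/
def braidAt (V : C) [Preadditive C] : (n i : ℕ) → (tpow V n ⟶ tpow V n)
  | 0, _ => 0
  | 1, _ => 0
  | n + 2, 0 => braidFirst V n
  | n + 2, i + 1 => tail V (braidAt V (n + 1) i)

variable [Preadditive C]

/-- The braided integer `[n,Ψ] = id + Ψ₁₂ + Ψ₁₂Ψ₂₃ + ⋯ + Ψ₁₂Ψ₂₃⋯Ψ_{n-1,n}` on `V^{⊗n}`
(products of operators, the rightmost one acting first), through
`[n+2,Ψ] = id + Ψ₁₂ (id ⊗ [n+1,Ψ])`. -/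
def braidedInt (V : C) : (n : ℕ) → (tpow V n ⟶ tpow V n)
  | 0 => 0
  | 1 => 𝟙 _
  | n + 2 => 𝟙 _ + tail V (braidedInt V (n + 1)) ≫ braidFirst V n

/-- The braided factorial `[n,Ψ]! = (id ⊗ [n-1,Ψ]!) [n,Ψ]` on `V^{⊗n}`, with `[0,Ψ]! = id`. -/
def braidedFactorial (V : C) : (n : ℕ) → (tpow V n ⟶ tpow V n)
  | 0 => 𝟙 _
  | n + 1 => braidedInt V (n + 1) ≫ tail V (braidedFactorial V n)

end Powers

/-! ## Maps induced on quotients and on tensor products of coproducts -/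

open Classical in
/-- The map `Y ⟶ Z` induced by `f : X ⟶ Z` on the quotient `e : X ⟶ Y` (`e` is an epimorphism in
all uses, so that the induced map is unique if it exists); `0` if `f` does not factor through `e`.
-/
def induced {C : Type u} [Category.{v} C] [HasZeroMorphisms C] {X Y Z : C} (e : X ⟶ Y)
    (f : X ⟶ Z) : Y ⟶ Z :=
  if h : ∃ g : Y ⟶ Z, e ≫ g = f then h.choose else 0

lemma comp_induced {C : Type u} [Category.{v} C] [HasZeroMorphisms C] {X Y Z : C} (e : X ⟶ Y)
    (f : X ⟶ Z) (h : ∃ g : Y ⟶ Z, e ≫ g = f) : e ≫ induced e f = f := by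
  rw [induced, dif_pos h]
  exact h.choose_spec

section TensorCoproduct

variable {C : Type u} [Category.{v} C] [MonoidalCategory C] [BraidedCategory C]
  [HasCoproductsOfShape ℕ C] [∀ X : C, PreservesColimitsOfShape (Discrete ℕ) (tensorLeft X)]

instance preservesCoproducts_tensorRight (X : C) :
    PreservesColimitsOfShape (Discrete ℕ) (tensorRight X) :=
  preservesColimitsOfShape_of_natIso (BraidedCategory.tensorLeftIsoTensorRight X)

/-- The map `(∐ F) ⊗ (∐ G) ⟶ X` with prescribed components `F m ⊗ G n ⟶ X`; it exists because
the tensor product preserves coproducts in each variable. -/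
def tensorSigmaDesc {F G : ℕ → C} {X : C} (f : ∀ m n, F m ⊗ G n ⟶ X) : (∐ F) ⊗ (∐ G) ⟶ X :=
  (PreservesCoproduct.iso (tensorRight (∐ G)) F).hom ≫
    Sigma.desc fun m => (PreservesCoproduct.iso (tensorLeft (F m)) G).hom ≫
      Sigma.desc fun n => f m n

lemma ι_tensorSigmaDesc {F G : ℕ → C} {X : C} (f : ∀ m n, F m ⊗ G n ⟶ X) (m n : ℕ) :
    (Sigma.ι F m ⊗ₘ Sigma.ι G n) ≫ tensorSigmaDesc f = f m n := by
  have h1 : Sigma.ι F m ▷ (∐ G) ≫ (PreservesCoproduct.iso (tensorRight (∐ G)) F).hom =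
      Sigma.ι (fun j => (tensorRight (∐ G)).obj (F j)) m := by
    rw [← Iso.eq_comp_inv, PreservesCoproduct.inv_hom, ι_comp_sigmaComparison]
    rfl
  have h2 : F m ◁ Sigma.ι G n ≫ (PreservesCoproduct.iso (tensorLeft (F m)) G).hom =
      Sigma.ι (fun j => (tensorLeft (F m)).obj (G j)) n := by
    rw [← Iso.eq_comp_inv, PreservesCoproduct.inv_hom, ι_comp_sigmaComparison]
    rfl
  rw [MonoidalCategory.tensorHom_def', tensorSigmaDesc, Category.assoc, reassoc_of% h1,
    Sigma.ι_desc, reassoc_of% h2, Sigma.ι_desc]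

end TensorCoproduct

/-! ## The tensor algebra as a braided bialgebra, and the braided symmetric algebra -/

section Symmetric

variable {C : Type u} [Category.{v} C] [Abelian C] [MonoidalCategory C] [BraidedCategory C]
  [HasCoproductsOfShape ℕ C]

/-- The tensor algebra `TV = ⨁ₙ V^{⊗n}`. -/
abbrev T (V : C) : C := ∐ tpow V

/-- The inclusion of `V^{⊗n}` in `TV`. -/
def inclT (V : C) (n : ℕ) : tpow V n ⟶ T V := Sigma.ι (tpow V) n

/-- The unit of `TV`. -/
def unitT (V : C) : 𝟙_ C ⟶ T V := (tnil V).hom ≫ inclT V 0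

/-- The inclusion of the generators `V` in `TV`. -/
def genT (V : C) : V ⟶ T V := (tone V).hom ≫ inclT V 1

/-- The projection of `TV` onto its degree 1 part `V`. -/
def projT (V : C) : T V ⟶ V :=
  Sigma.desc fun n => match n with
    | 1 => (tone V).inv
    | _ => 0

/-- `B₊(V) = TV / ⨁ₙ ker [n,Ψ]!`. -/
abbrev B (V : C) : C :=
  cokernel (Limits.Sigma.map fun n => kernel.ι (braidedFactorial V n))

/-- The quotient map `TV ⟶ B₊(V)`. -/
def quotB (V : C) : T V ⟶ B V := cokernel.π _

/-- The unit of `B₊(V)`. -/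
def unitB (V : C) : 𝟙_ C ⟶ B V := unitT V ≫ quotB V

/-- The projection `ϖ : B₊(V) ⟶ V` to degree 1, induced by that of `TV`. -/
def varpi (V : C) : B V ⟶ V := induced (quotB V) (projT V)

variable [∀ X : C, PreservesColimitsOfShape (Discrete ℕ) (tensorLeft X)]

/-- The product of `TV`. -/
def mulT (V : C) : T V ⊗ T V ⟶ T V :=
  tensorSigmaDesc fun m n => tmul V m n (m + n) rfl ≫ inclT V (m + n)

/-- The coproduct of `TV` on generators: `Δ v = v ⊗ 1 + 1 ⊗ v`. -/
def primT (V : C) : V ⟶ T V ⊗ T V :=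
  (ρ_ V).inv ≫ (genT V ⊗ₘ unitT V) + (λ_ V).inv ≫ (unitT V ⊗ₘ genT V)

/-- The coproduct of `TV` on `V^{⊗n}`: `Δ 1 = 1 ⊗ 1` and `Δ (v x) = (Δ v) (Δ x)`, the product on
the right being that of the braided tensor product algebra `TV ⊗ TV`, namely
`(a ⊗ b)(c ⊗ d) = a Ψ(b ⊗ c) d`. -/
def coprodPow (V : C) : (n : ℕ) → (tpow V n ⟶ T V ⊗ T V)
  | 0 => (tnil V).inv ≫ (λ_ (𝟙_ C)).inv ≫ (unitT V ⊗ₘ unitT V)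
  | n + 1 => (tcons V n).inv ≫ (primT V ⊗ₘ coprodPow V n) ≫
      tensorμ (T V) (T V) (T V) (T V) ≫ (mulT V ⊗ₘ mulT V)

/-- The braided coproduct `TV ⟶ TV ⊗ TV` with `V` primitive. -/
def coprodT (V : C) : T V ⟶ T V ⊗ T V := Sigma.desc (coprodPow V)

/-- The product of `B₊(V)`, induced by that of `TV`. -/
def mulB (V : C) : B V ⊗ B V ⟶ B V := induced (quotB V ⊗ₘ quotB V) (mulT V ≫ quotB V)

/-- The braided coproduct of `B₊(V)`, induced by that of `TV`. -/
def coprodB (V : C) : B V ⟶ B V ⊗ B V :=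
  induced (quotB V) (coprodT V ≫ (quotB V ⊗ₘ quotB V))

end Symmetric

/-! ## The braided exterior algebra -/

section Exterior

variable {C : Type u} [Category.{v} C] [Abelian C] [MonoidalCategory C] [BraidedCategory C]

/-- The relations of `Λ(V)` in degree `n`. The image of this map is the sum of the images of the
`id + Ψ_{i,i+1}`, `1 ≤ i < n`, and this is the degree `n` part of the two-sided ideal of `TV`
generated by the image of `id + Ψ : V ⊗ V ⟶ V ⊗ V`. -/
def relExt (V : C) (n : ℕ) : (∐ fun _ : Fin (n - 1) => tpow V n) ⟶ tpow V n :=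
  Sigma.desc fun i => 𝟙 _ + braidAt V n i

/-- The degree `n` part `Λⁿ` of the braided exterior algebra `Λ(V) = TV / ⟨Im(id + Ψ)⟩`. -/
abbrev Lam (V : C) (n : ℕ) : C := cokernel (relExt V n)

/-- The quotient map `V^{⊗n} ⟶ Λⁿ`. -/
def quotExt (V : C) (n : ℕ) : tpow V n ⟶ Lam V n := cokernel.π _

/-- The unit of `Λ(V)`. -/
def unitExt (V : C) : 𝟙_ C ⟶ Lam V 0 := (tnil V).hom ≫ quotExt V 0

/-- The identification of `V` with `Λ¹`. -/
def genExt (V : C) : V ⟶ Lam V 1 := (tone V).hom ≫ quotExt V 1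

/-- The product `Λᵐ ⊗ Λⁿ ⟶ Λᵏ`, `k = m + n`, of `Λ(V)`, induced by that of `TV`. -/
def wedge (V : C) (m n k : ℕ) (h : m + n = k) : Lam V m ⊗ Lam V n ⟶ Lam V k :=
  induced (quotExt V m ⊗ₘ quotExt V n) (tmul V m n k h ≫ quotExt V k)

end Exterior

/-! ## The bigraded algebra `Ω` and its differentials -/

section Omega

variable {C : Type u} [Category.{v} C] [Abelian C] [MonoidalCategory C] [BraidedCategory C]
  [HasCoproductsOfShape ℕ C] [∀ X : C, PreservesColimitsOfShape (Discrete ℕ) (tensorLeft X)]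

/-- `Ω^{p,q} = Λᵖ ⊗ B₊(V) ⊗ Λ^q`. -/
abbrev Omega (V : C) (p q : ℕ) : C := Lam V p ⊗ (B V ⊗ Lam V q)

/-- The unit `1 ⊗ 1 ⊗ 1` of `Ω`. -/
def unitOmega (V : C) : 𝟙_ C ⟶ Omega V 0 0 :=
  (λ_ (𝟙_ C)).inv ≫ (unitExt V ⊗ₘ ((λ_ (𝟙_ C)).inv ≫ (unitB V ⊗ₘ unitExt V)))

/-- The product of the braided (super) tensor product algebra `Λ ⊗ B ⊗ Λ`:
`(ω ⊗ y)(ω' ⊗ y') = (-1)^{q p'} ω Ψ(y ⊗ ω') y'` for `ω, ω'` in `Λᵖ, Λ^{p'}` and `y, y'` in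
`B ⊗ Λ^q, B ⊗ Λ^{q'}`, where `(b ⊗ η)(b' ⊗ η') = b Ψ(η ⊗ b') η'` in `B ⊗ Λ`. -/
def mulOmega (V : C) (p q p' q' r s : ℕ) (hr : p + p' = r) (hs : q + q' = s) :
    Omega V p q ⊗ Omega V p' q' ⟶ Omega V r s :=
  ((-1 : ℤ) ^ (q * p')) •
    (tensorμ (Lam V p) (B V ⊗ Lam V q) (Lam V p') (B V ⊗ Lam V q') ≫
      (wedge V p p' r hr ⊗ₘ
        (tensorμ (B V) (Lam V q) (B V) (Lam V q') ≫ (mulB V ⊗ₘ wedge V q q' s hs))))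

/-- `(∧ ⊗ id)(id ⊗ ϖ ⊗ id)(id ⊗ Δ) : Λᵖ ⊗ B ⟶ Λ^{p+1} ⊗ B`. -/
def delRight (V : C) (p : ℕ) : Lam V p ⊗ B V ⟶ Lam V (p + 1) ⊗ B V :=
  Lam V p ◁ coprodB V ≫ Lam V p ◁ ((varpi V ≫ genExt V) ▷ B V) ≫
    (α_ (Lam V p) (Lam V 1) (B V)).inv ≫ wedge V p 1 (p + 1) rfl ▷ B V

/-- `(id ⊗ ∧)(id ⊗ ϖ ⊗ id)(Δ ⊗ id) : B ⊗ Λ^q ⟶ B ⊗ Λ^{q+1}`. -/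
def delLeft (V : C) (q : ℕ) : B V ⊗ Lam V q ⟶ B V ⊗ Lam V (q + 1) :=
  coprodB V ▷ Lam V q ≫ (α_ (B V) (B V) (Lam V q)).hom ≫
    B V ◁ ((varpi V ≫ genExt V) ▷ Lam V q) ≫
    B V ◁ wedge V 1 q (q + 1) (Nat.add_comm 1 q)

/-- `∂ = (-1)ᵖ ((∧ ⊗ id)(id ⊗ ϖ ⊗ id)(id ⊗ Δ)) ⊗ id : Ω^{p,q} ⟶ Ω^{p+1,q}`. -/
def del (V : C) (p q : ℕ) : Omega V p q ⟶ Omega V (p + 1) q :=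
  ((-1 : ℤ) ^ p) • ((α_ (Lam V p) (B V) (Lam V q)).inv ≫ delRight V p ▷ Lam V q ≫
    (α_ (Lam V (p + 1)) (B V) (Lam V q)).hom)

/-- `∂̄ = (-1)ᵖ id ⊗ ((id ⊗ ∧)(id ⊗ ϖ ⊗ id)(Δ ⊗ id)) : Ω^{p,q} ⟶ Ω^{p,q+1}`. -/
def delBar (V : C) (p q : ℕ) : Omega V p q ⟶ Omega V p (q + 1) :=
  ((-1 : ℤ) ^ p) • (Lam V p ◁ delLeft V q)

/-- The structure maps of `B₊(V)` and `Λ(V)` are well defined: those of the tensor algebra do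
descend to the quotients. -/
structure WellDefined (V : C) : Prop where
  mulB : (quotB V ⊗ₘ quotB V) ≫ mulB V = mulT V ≫ quotB V
  coprodB : quotB V ≫ coprodB V = coprodT V ≫ (quotB V ⊗ₘ quotB V)
  varpi : quotB V ≫ varpi V = projT V
  wedge : ∀ (m n k : ℕ) (h : m + n = k),
    (quotExt V m ⊗ₘ quotExt V n) ≫ wedge V m n k h = tmul V m n k h ≫ quotExt V k

end Omega

/-! ## Double complexes -/

/-- A bigraded object `Ω` with a product, a unit and maps `∂`, `∂̄` of bidegree `(1,0)`, `(0,1)` is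
a double complex (over the algebra `Ω^{0,0}`): `Ω` is an associative unital bigraded algebra, `∂`
and `∂̄` are graded derivations for the total degree, they square to zero and they anticommute. -/
structure IsDoubleComplex {C : Type u} [Category.{v} C] [Preadditive C] [MonoidalCategory C]
    (Ω : ℕ → ℕ → C) (unit : 𝟙_ C ⟶ Ω 0 0)
    (mul : ∀ p q p' q' r s : ℕ, p + p' = r → q + q' = s → (Ω p q ⊗ Ω p' q' ⟶ Ω r s))
    (d : ∀ p q, Ω p q ⟶ Ω (p + 1) q) (dbar : ∀ p q, Ω p q ⟶ Ω p (q + 1)) : Prop where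
  one_mul : ∀ p q,
    (λ_ (Ω p q)).inv ≫ unit ▷ Ω p q ≫ mul 0 0 p q p q (Nat.zero_add p) (Nat.zero_add q) = 𝟙 _
  mul_one : ∀ p q,
    (ρ_ (Ω p q)).inv ≫ Ω p q ◁ unit ≫ mul p q 0 0 p q (Nat.add_zero p) (Nat.add_zero q) = 𝟙 _
  mul_assoc : ∀ (p₁ q₁ p₂ q₂ p₃ q₃ p₁₂ q₁₂ p₂₃ q₂₃ p q : ℕ)
    (h₁ : p₁ + p₂ = p₁₂) (k₁ : q₁ + q₂ = q₁₂) (h₂ : p₂ + p₃ = p₂₃) (k₂ : q₂ + q₃ = q₂₃)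
    (h₃ : p₁₂ + p₃ = p) (k₃ : q₁₂ + q₃ = q) (h₄ : p₁ + p₂₃ = p) (k₄ : q₁ + q₂₃ = q),
    mul p₁ q₁ p₂ q₂ p₁₂ q₁₂ h₁ k₁ ▷ Ω p₃ q₃ ≫ mul p₁₂ q₁₂ p₃ q₃ p q h₃ k₃ =
      (α_ (Ω p₁ q₁) (Ω p₂ q₂) (Ω p₃ q₃)).hom ≫
        Ω p₁ q₁ ◁ mul p₂ q₂ p₃ q₃ p₂₃ q₂₃ h₂ k₂ ≫ mul p₁ q₁ p₂₃ q₂₃ p q h₄ k₄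
  d_mul : ∀ (p q p' q' r s : ℕ) (hr : p + p' = r) (hs : q + q' = s),
    mul p q p' q' r s hr hs ≫ d r s =
      d p q ▷ Ω p' q' ≫ mul (p + 1) q p' q' (r + 1) s (by omega) hs +
        ((-1 : ℤ) ^ (p + q)) •
          (Ω p q ◁ d p' q' ≫ mul p q (p' + 1) q' (r + 1) s (by omega) hs)
  dbar_mul : ∀ (p q p' q' r s : ℕ) (hr : p + p' = r) (hs : q + q' = s),
    mul p q p' q' r s hr hs ≫ dbar r s =
      dbar p q ▷ Ω p' q' ≫ mul p (q + 1) p' q' r (s + 1) hr (by omega) +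
        ((-1 : ℤ) ^ (p + q)) •
          (Ω p q ◁ dbar p' q' ≫ mul p q p' (q' + 1) r (s + 1) hr (by omega))
  d_d : ∀ p q, d p q ≫ d (p + 1) q = 0
  dbar_dbar : ∀ p q, dbar p q ≫ dbar p (q + 1) = 0
  anticomm : ∀ p q, d p q ≫ dbar (p + 1) q + dbar p q ≫ d p (q + 1) = 0

end

end BraidedPlane

/-! Everything is governed by the degree-one parts of the coproduct, $D : TV\to V\otimes TV$
(`leftD`) and $D' : TV\to TV\otimes V$ (`rightD`). Since $\Delta(vx)=(\Delta v)(\Delta x)$, they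
satisfy $D(vx)=v\otimes x+\Psi(v\otimes x_1)x_2$ for $Dx=x_1\otimes x_2$, and $D'(vx)=vx_1\otimes
x_2+\Psi(v\otimes x)$ for $D'x=x_1\otimes x_2$. A morphism out of $TV$ is determined by its value on
$1$ and by such a recursion (`T_ext`, `T_ext_of_recursion`), so most identities on $TV$ are proved
by checking that both sides obey the same recursion. This gives the braided Leibniz rules
(`mulT_leftD`, `mulT_rightD`), the commutation of $D$ with $D'$ (`leftD_rightD`), and the vanishing
of $D^2$ and $D'^2$ after any $Q:V\otimes V\to W$ with $Q\Psi=-Q$ (`leftD_leftD`, `rightD_rightD`).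

Descent to $B$: on $V^{\otimes(n+1)}$ the map $D$ is the braided integer $[n+1,\Psi]$, so the
factorials satisfy $F=1\,\varepsilon+\cdot\,(\mathrm{id}\otimes F)D$ (`factT_eq`). With the Leibniz
rule this yields $F(xy)=s(Fx\otimes Fy)$ for a shuffle map $s$ (`exists_shuffle`), so $\ker F$ is an
ideal; with coassociativity it yields $(F\otimes F)\Delta=G F$ in each degree
(`exists_deconcatenation`). Exactness of $\otimes$ then turns vanishing under $F\otimes F$ into
vanishing in $B\otimes B$ (`comp_tensorHom_eq_zero`).

In $\Lambda$ the relation $\wedge\Psi=-\wedge$ on $V\otimes V$ propagates to graded commutation of a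
generator with $\Lambda^p$, through $\Psi$ whichever side the generator starts on
(`wedgeGenLeft_eq`, `wedgeGenRight_eq`). Combined with the Leibniz rules on $B$, this makes
$\partial$ and $\bar\partial$ graded derivations. Both square to zero by taking $Q=\wedge$, and
anticommute because $D$ and $D'$ commute while the signs $(-1)^p$ differ. Associativity of $\Omega$
is that of iterated braided tensor products, with a sign exponent that is bilinear. -/

namespace BraidedPlane

universe v u

set_option linter.unusedSectionVars false

/-! ## Right-nested calculus

Morphisms between tensor products of at most two factors, acting on the first factors of a
right-nested tensor product with an arbitrary tail `M`. -/

section Calculus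

variable {C : Type u} [Category.{v} C] [MonoidalCategory C]

/-- A morphism `X ⊗ Y ⟶ Z` acting on the first two factors of `X ⊗ (Y ⊗ M)`. -/
def op21 {X Y Z : C} (f : X ⊗ Y ⟶ Z) (M : C) : X ⊗ (Y ⊗ M) ⟶ Z ⊗ M :=
  (α_ X Y M).inv ≫ f ▷ M

/-- A morphism `X ⟶ Y ⊗ Z` acting on the first factor of `X ⊗ M`. -/
def op12 {X Y Z : C} (f : X ⟶ Y ⊗ Z) (M : C) : X ⊗ M ⟶ Y ⊗ (Z ⊗ M) :=
  f ▷ M ≫ (α_ Y Z M).hom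

lemma op21_tail {X Y Z : C} (f : X ⊗ Y ⟶ Z) {M N : C} (g : M ⟶ N) :
    op21 f M ≫ Z ◁ g = X ◁ Y ◁ g ≫ op21 f N := by
  rw [op21, op21, Category.assoc, ← whisker_exchange, associator_inv_naturality_right_assoc]

lemma op12_tail {X Y Z : C} (f : X ⟶ Y ⊗ Z) {M N : C} (g : M ⟶ N) :
    op12 f M ≫ Y ◁ Z ◁ g = X ◁ g ≫ op12 f N := by
  rw [op12, op12, Category.assoc, ← associator_naturality_right, whisker_exchange_assoc]

lemma op21_comp {X Y Z W : C} (f : X ⊗ Y ⟶ Z) (g : Z ⟶ W) (M : C) :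
    op21 (f ≫ g) M = op21 f M ≫ g ▷ M := by
  simp [op21]

lemma op12_comp {X Y Z W : C} (g : W ⟶ X) (f : X ⟶ Y ⊗ Z) (M : C) :
    op12 (g ≫ f) M = g ▷ M ≫ op12 f M := by
  simp [op12]

lemma op21_whiskerRight_comp {X X' Y Z : C} (g : X ⟶ X') (f : X' ⊗ Y ⟶ Z) (M : C) :
    op21 (g ▷ Y ≫ f) M = g ▷ (Y ⊗ M) ≫ op21 f M := by
  simp [op21]

lemma op21_whiskerLeft_comp {X Y Y' Z : C} (g : Y ⟶ Y') (f : X ⊗ Y' ⟶ Z) (M : C) :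
    op21 (X ◁ g ≫ f) M = X ◁ g ▷ M ≫ op21 f M := by
  simp [op21]

lemma op12_comp_whiskerRight {X Y Y' Z : C} (f : X ⟶ Y ⊗ Z) (g : Y ⟶ Y') (M : C) :
    op12 (f ≫ g ▷ Z) M = op12 f M ≫ g ▷ (Z ⊗ M) := by
  simp [op12]

lemma op12_comp_whiskerLeft {X Y Z Z' : C} (f : X ⟶ Y ⊗ Z) (g : Z ⟶ Z') (M : C) :
    op12 (f ≫ Y ◁ g) M = op12 f M ≫ Y ◁ g ▷ M := by
  simp [op12]

variable [BraidedCategory C]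

/-- The braiding of the first two factors of `X ⊗ (Y ⊗ M)`. -/
def br (X Y M : C) : X ⊗ (Y ⊗ M) ⟶ Y ⊗ (X ⊗ M) :=
  (α_ X Y M).inv ≫ (β_ X Y).hom ▷ M ≫ (α_ Y X M).hom

lemma br_tail (X Y : C) {M N : C} (g : M ⟶ N) :
    br X Y M ≫ Y ◁ X ◁ g = X ◁ Y ◁ g ≫ br X Y N := by
  rw [br, br, Category.assoc, Category.assoc, ← associator_naturality_right,
    ← whisker_exchange_assoc, associator_inv_naturality_right_assoc]

lemma br_naturality_left {X X' : C} (f : X ⟶ X') (Y M : C) :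
    f ▷ (Y ⊗ M) ≫ br X' Y M = br X Y M ≫ Y ◁ f ▷ M := by
  simp only [br, Category.assoc, associator_inv_naturality_left_assoc]
  rw [← comp_whiskerRight_assoc, BraidedCategory.braiding_naturality_left]
  simp

lemma br_naturality_right {Y Y' : C} (X : C) (f : Y ⟶ Y') (M : C) :
    X ◁ f ▷ M ≫ br X Y' M = br X Y M ≫ f ▷ (X ⊗ M) := by
  simp only [br, Category.assoc, associator_inv_naturality_middle_assoc]
  rw [← comp_whiskerRight_assoc, BraidedCategory.braiding_naturality_right]
  simp

/-- The hexagon axiom in the presence of a tail. Together with naturality of the braiding, it lets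
products and coproducts slide across a strand in the four lemmas `op21_br_right`, `op21_br_left`,
`op12_br_right`, `op12_br_left`. -/
lemma br_tensor_right (X Y Z M : C) :
    X ◁ (α_ Y Z M).inv ≫ br X (Y ⊗ Z) M =
      br X Y (Z ⊗ M) ≫ Y ◁ br X Z M ≫ (α_ Y Z (X ⊗ M)).inv := by
  simp only [br, BraidedCategory.braiding_tensor_right_hom]
  monoidal

lemma br_tensor_left (X Y Z M : C) :
    (α_ X Y (Z ⊗ M)).inv ≫ br (X ⊗ Y) Z M =
      X ◁ br Y Z M ≫ br X Z (Y ⊗ M) ≫ Z ◁ (α_ X Y M).inv := by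
  simp only [br, BraidedCategory.braiding_tensor_left_hom]
  monoidal

lemma op21_br_right (X : C) {Y Z W : C} (f : Y ⊗ Z ⟶ W) (M : C) :
    X ◁ op21 f M ≫ br X W M = br X Y (Z ⊗ M) ≫ Y ◁ br X Z M ≫ op21 f (X ⊗ M) := by
  rw [op21, whiskerLeft_comp, Category.assoc, br_naturality_right, ← Category.assoc,
    br_tensor_right]
  simp [op21]

lemma op21_br_left {X Y W : C} (f : X ⊗ Y ⟶ W) (Z M : C) :
    op21 f (Z ⊗ M) ≫ br W Z M = X ◁ br Y Z M ≫ br X Z (Y ⊗ M) ≫ Z ◁ op21 f M := by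
  rw [op21, Category.assoc, br_naturality_left, ← Category.assoc, br_tensor_left]
  simp [op21]

lemma op12_br_right (X : C) {W Y Z : C} (f : W ⟶ Y ⊗ Z) (M : C) :
    X ◁ op12 f M ≫ br X Y (Z ⊗ M) ≫ Y ◁ br X Z M = br X W M ≫ op12 f (X ⊗ M) := by
  have h : br X Y (Z ⊗ M) ≫ Y ◁ br X Z M =
      X ◁ (α_ Y Z M).inv ≫ br X (Y ⊗ Z) M ≫ (α_ Y Z (X ⊗ M)).hom := by
    rw [← Category.assoc, br_tensor_right]; simp
  rw [h, op12, op12]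
  simp [reassoc_of% @br_naturality_right]

lemma op12_br_left {X Y W : C} (f : W ⟶ X ⊗ Y) (Z M : C) :
    op12 f (Z ⊗ M) ≫ X ◁ br Y Z M ≫ br X Z (Y ⊗ M) = br W Z M ≫ Z ◁ op12 f M := by
  have := br_tensor_left X Y Z M
  have h2 : X ◁ br Y Z M ≫ br X Z (Y ⊗ M) = (α_ X Y (Z ⊗ M)).inv ≫ br (X ⊗ Y) Z M ≫
      Z ◁ (α_ X Y M).hom := by
    rw [reassoc_of% this]; simp
  rw [h2, op12, op12]
  simp only [Category.assoc, whiskerLeft_comp, Iso.hom_inv_id_assoc]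
  rw [← reassoc_of% @br_naturality_left]

lemma br_unit_left (X M : C) : br (𝟙_ C) X M = (λ_ (X ⊗ M)).hom ≫ X ◁ (λ_ M).inv := by
  simp only [br, braiding_tensorUnit_left]
  monoidal

lemma br_unit_right (X M : C) : br X (𝟙_ C) M = X ◁ (λ_ M).hom ≫ (λ_ (X ⊗ M)).inv := by
  simp only [br, braiding_tensorUnit_right]
  monoidal

end Calculus

/-! ## The tensor algebra -/

section Calculus

variable {C : Type u} [Category.{v} C] [MonoidalCategory C]

/-- An associativity law holds with any tail. -/
lemma op21_assoc {X Y Z W A U : C} {f : X ⊗ Y ⟶ Z} {g : Z ⊗ W ⟶ U} {h : Y ⊗ W ⟶ A}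
    {k : X ⊗ A ⟶ U} (e : op21 f W ≫ g = X ◁ h ≫ k) (M : C) :
    op21 f (W ⊗ M) ≫ op21 g M = X ◁ op21 h M ≫ op21 k M := by
  have h1 : op21 f (W ⊗ M) ≫ op21 g M =
      X ◁ (α_ Y W M).inv ≫ (α_ X (Y ⊗ W) M).inv ≫ (op21 f W ≫ g) ▷ M := by
    simp only [op21]; monoidal
  have h2 : X ◁ op21 h M ≫ op21 k M =
      X ◁ (α_ Y W M).inv ≫ (α_ X (Y ⊗ W) M).inv ≫ (X ◁ h ≫ k) ▷ M := by
    simp only [op21]; monoidal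
  rw [h1, h2, e]

/-- A coassociativity law holds with any tail. -/
lemma op12_coassoc {X Y Z W A U : C} {f : U ⟶ Z ⊗ W} {g : Z ⟶ X ⊗ Y} {h : U ⟶ X ⊗ A}
    {k : A ⟶ Y ⊗ W} (e : f ≫ op12 g W = h ≫ X ◁ k) (M : C) :
    op12 f M ≫ op12 g (W ⊗ M) = op12 h M ≫ X ◁ op12 k M := by
  have h1 : op12 f M ≫ op12 g (W ⊗ M) =
      (f ≫ op12 g W) ▷ M ≫ (α_ X (Y ⊗ W) M).hom ≫ X ◁ (α_ Y W M).hom := by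
    simp only [op12]; monoidal
  have h2 : op12 h M ≫ X ◁ op12 k M =
      (h ≫ X ◁ k) ▷ M ≫ (α_ X (Y ⊗ W) M).hom ≫ X ◁ (α_ Y W M).hom := by
    simp only [op12]; monoidal
  rw [h1, h2, e]

end Calculus

section TensorPower

variable {C : Type u} [Category.{v} C] [MonoidalCategory C]

lemma tnil_tmul (V : C) (n : ℕ) :
    (tnil V).hom ▷ tpow V n ≫ tmul V 0 n n (Nat.zero_add n) = (λ_ (tpow V n)).hom := by
  simp [tmul, ← comp_whiskerRight_assoc]

lemma tcons_tmul (V : C) (m n k : ℕ) (h : m + n = k) :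
    (tcons V m).hom ▷ tpow V n ≫ tmul V (m + 1) n (k + 1) (by omega) =
      (α_ V (tpow V m) (tpow V n)).hom ≫ V ◁ tmul V m n k h ≫ (tcons V k).hom := by
  simp [tmul, ← comp_whiskerRight_assoc]

end TensorPower

/-! ### Testing morphisms on the summands of a tensored coproduct -/

section SigmaExt

variable {C : Type u} [Category.{v} C] [MonoidalCategory C] {J : Type*} [HasCoproductsOfShape J C]

lemma whiskerLeft_sigma_hom_ext {F : J → C} {X Y : C}
    [PreservesColimitsOfShape (Discrete J) (tensorLeft X)] {f g : X ⊗ (∐ F) ⟶ Y}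
    (h : ∀ n, X ◁ Sigma.ι F n ≫ f = X ◁ Sigma.ι F n ≫ g) : f = g := by
  rw [← cancel_epi (PreservesCoproduct.iso (tensorLeft X) F).inv]
  refine Sigma.hom_ext _ _ fun n => ?_
  rw [PreservesCoproduct.inv_hom, ι_comp_sigmaComparison_assoc, ι_comp_sigmaComparison_assoc]
  exact h n

lemma whiskerRight_sigma_hom_ext {F : J → C} {M Y : C}
    [PreservesColimitsOfShape (Discrete J) (tensorRight M)] {f g : (∐ F) ⊗ M ⟶ Y}
    (h : ∀ n, Sigma.ι F n ▷ M ≫ f = Sigma.ι F n ▷ M ≫ g) : f = g := by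
  rw [← cancel_epi (PreservesCoproduct.iso (tensorRight M) F).inv]
  refine Sigma.hom_ext _ _ fun n => ?_
  rw [PreservesCoproduct.inv_hom, ι_comp_sigmaComparison_assoc, ι_comp_sigmaComparison_assoc]
  exact h n

end SigmaExt

section TensorAlgebra

variable {C : Type u} [Category.{v} C] [Abelian C] [MonoidalCategory C] [BraidedCategory C]
  [HasCoproductsOfShape ℕ C]

lemma T_hom_ext {V Y : C} {f g : T V ⟶ Y} (h : ∀ n, inclT V n ≫ f = inclT V n ≫ g) : f = g :=
  Sigma.hom_ext _ _ h

variable [∀ X : C, PreservesColimitsOfShape (Discrete ℕ) (tensorLeft X)]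

lemma whiskerLeft_T_hom_ext {V X Y : C} {f g : X ⊗ T V ⟶ Y}
    (h : ∀ n, X ◁ inclT V n ≫ f = X ◁ inclT V n ≫ g) : f = g :=
  whiskerLeft_sigma_hom_ext h

lemma whiskerRight_T_hom_ext {V M Y : C} {f g : T V ⊗ M ⟶ Y}
    (h : ∀ n, inclT V n ▷ M ≫ f = inclT V n ▷ M ≫ g) : f = g :=
  whiskerRight_sigma_hom_ext h

/-- Left multiplication by generators `V ⊗ TV ⟶ TV`. -/
noncomputable def lcons (V : C) : V ⊗ T V ⟶ T V :=
  (PreservesCoproduct.iso (tensorLeft V) (tpow V)).hom ≫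
    Sigma.desc fun n => (tcons V n).hom ≫ inclT V (n + 1)

lemma incl_lcons (V : C) (n : ℕ) :
    V ◁ inclT V n ≫ lcons V = (tcons V n).hom ≫ inclT V (n + 1) := by
  have h2 : V ◁ inclT V n ≫ (PreservesCoproduct.iso (tensorLeft V) (tpow V)).hom =
      Sigma.ι (fun j => (tensorLeft V).obj (tpow V j)) n := by
    rw [← Iso.eq_comp_inv, PreservesCoproduct.inv_hom, ι_comp_sigmaComparison]
    rfl
  rw [lcons, reassoc_of% h2, Sigma.ι_desc]

lemma incl_mulT (V : C) (m n : ℕ) :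
    (inclT V m ⊗ₘ inclT V n) ≫ mulT V = tmul V m n (m + n) rfl ≫ inclT V (m + n) :=
  ι_tensorSigmaDesc _ m n

lemma tmul_inclT_congr (V : C) {m n k l : ℕ} (h : m + n = k) (h' : m + n = l) :
    tmul V m n k h ≫ inclT V k = tmul V m n l h' ≫ inclT V l := by
  subst h; subst h'; rfl

lemma unitT_mulT (V : C) : unitT V ▷ T V ≫ mulT V = (λ_ (T V)).hom := by
  refine whiskerLeft_T_hom_ext fun n => ?_
  rw [leftUnitor_naturality, unitT, ← tnil_tmul, Category.assoc,
    ← tmul_inclT_congr V rfl (Nat.zero_add n), ← incl_mulT]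
  simp only [MonoidalCategory.tensorHom_def', comp_whiskerRight, Category.assoc]
  rw [whisker_exchange_assoc]

instance (X Y M : C) : IsIso (br X Y M) := by unfold br; infer_instance

/-- The invertible braiding brings $TV$ to the front, where preservation of coproducts applies
directly. -/
lemma whiskerLeft_whiskerRight_T_hom_ext {V X M Y : C} {f g : X ⊗ (T V ⊗ M) ⟶ Y}
    (h : ∀ n, X ◁ inclT V n ▷ M ≫ f = X ◁ inclT V n ▷ M ≫ g) : f = g := by
  rw [← cancel_epi (br (T V) X M)]
  refine whiskerRight_T_hom_ext fun n => ?_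
  rw [reassoc_of% @br_naturality_left, reassoc_of% @br_naturality_left, h]

/-- Associativity with a generator in front is built into the recursive definition of concatenation;
it is checked on each $V\otimes V^{\otimes m}\otimes V^{\otimes n}$. Full associativity follows from
it by recursion. -/
lemma lcons_mulT (V : C) :
    lcons V ▷ T V ≫ mulT V = (α_ V (T V) (T V)).hom ≫ V ◁ mulT V ≫ lcons V := by
  rw [← cancel_epi (α_ V (T V) (T V)).inv, Iso.inv_hom_id_assoc]
  refine whiskerLeft_whiskerRight_T_hom_ext fun m => ?_
  rw [← cancel_epi (α_ V (tpow V m) (T V)).hom]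
  refine whiskerLeft_T_hom_ext fun n => ?_
  have h1 : V ◁ inclT V m ▷ T V ≫ (α_ V (T V) (T V)).inv ≫ lcons V ▷ T V ≫ mulT V =
      (α_ V (tpow V m) (T V)).inv ≫ (tcons V m).hom ▷ T V ≫ inclT V (m + 1) ▷ T V ≫ mulT V := by
    rw [associator_inv_naturality_middle_assoc, ← comp_whiskerRight_assoc, incl_lcons]
    simp
  have h2 : (V ⊗ tpow V m) ◁ inclT V n ≫ (α_ V (tpow V m) (T V)).hom ≫
      V ◁ inclT V m ▷ T V ≫ V ◁ mulT V ≫ lcons V =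
      (α_ V (tpow V m) (tpow V n)).hom ≫ V ◁ ((inclT V m ⊗ₘ inclT V n) ≫ mulT V) ≫ lcons V := by
    simp only [MonoidalCategory.tensorHom_def', whiskerLeft_comp, Category.assoc,
      tensor_whiskerLeft, Iso.inv_hom_id_assoc]
  rw [h1, h2, incl_mulT, whiskerLeft_comp, Category.assoc, incl_lcons, Iso.hom_inv_id_assoc,
    whisker_exchange_assoc]
  have h3 := incl_mulT V (m + 1) n
  rw [MonoidalCategory.tensorHom_def', Category.assoc] at h3
  rw [h3, tmul_inclT_congr V rfl (show m + 1 + n = (m + n) + 1 by omega), ← Category.assoc,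
    tcons_tmul V m n (m + n) rfl]
  simp

section Ext

variable [MonoidalPreadditive C]

/-- Uniqueness of morphisms out of `TV ⊗ M` defined by recursion. -/
lemma T_ext {V M Y : C} {f g : T V ⊗ M ⟶ Y} (φ : V ⊗ Y ⟶ Y) (r : V ⊗ (T V ⊗ M) ⟶ Y)
    (h0 : unitT V ▷ M ≫ f = unitT V ▷ M ≫ g)
    (hf : op21 (lcons V) M ≫ f = V ◁ f ≫ φ + r) (hg : op21 (lcons V) M ≫ g = V ◁ g ≫ φ + r) :
    f = g := by
  refine whiskerRight_T_hom_ext fun n => ?_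
  induction n with
  | zero =>
    have : inclT V 0 = (tnil V).inv ≫ unitT V := by simp [unitT]
    rw [this, comp_whiskerRight, Category.assoc, Category.assoc, h0]
  | succ n ih =>
    have h : inclT V (n + 1) ▷ M =
        (tcons V n).inv ▷ M ≫ (α_ V (tpow V n) M).hom ≫ V ◁ inclT V n ▷ M ≫
          op21 (lcons V) M := by
      rw [op21, associator_inv_naturality_middle_assoc, ← comp_whiskerRight, incl_lcons]
      simp [← comp_whiskerRight]
    have key : V ◁ inclT V n ▷ M ≫ V ◁ f = V ◁ inclT V n ▷ M ≫ V ◁ g := by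
      rw [← whiskerLeft_comp, ih, whiskerLeft_comp]
    simp only [h, Category.assoc, hf, hg, Preadditive.comp_add, reassoc_of% key]

/-- Uniqueness of morphisms out of `TV` defined by recursion. -/
lemma T_ext_of_recursion {V Y : C} {f g : T V ⟶ Y} (φ : V ⊗ Y ⟶ Y) (r : V ⊗ T V ⟶ Y)
    (h0 : unitT V ≫ f = unitT V ≫ g)
    (hf : lcons V ≫ f = V ◁ f ≫ φ + r) (hg : lcons V ≫ g = V ◁ g ≫ φ + r) :
    f = g := by
  refine T_hom_ext fun n => ?_
  induction n with
  | zero =>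
    have : inclT V 0 = (tnil V).inv ≫ unitT V := by simp [unitT]
    rw [this, Category.assoc, Category.assoc, h0]
  | succ n ih =>
    have h : inclT V (n + 1) = (tcons V n).inv ≫ V ◁ inclT V n ≫ lcons V := by
      rw [incl_lcons]; simp
    have key : V ◁ inclT V n ≫ V ◁ f = V ◁ inclT V n ≫ V ◁ g := by
      rw [← whiskerLeft_comp, ih, whiskerLeft_comp]
    simp only [h, Category.assoc, hf, hg, Preadditive.comp_add, reassoc_of% key]

end Ext

lemma unitT_op21_mulT (V M : C) :
    unitT V ▷ (T V ⊗ M) ≫ op21 (mulT V) M = (λ_ (T V ⊗ M)).hom := by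
  rw [← op21_whiskerRight_comp, unitT_mulT, op21]
  monoidal

lemma op21_lcons_mulT (V : C) :
    op21 (lcons V) (T V) ≫ mulT V = V ◁ mulT V ≫ lcons V := by
  rw [op21, Category.assoc, lcons_mulT, Iso.inv_hom_id_assoc]

lemma lcons_op21_mulT (V M : C) :
    op21 (lcons V) (T V ⊗ M) ≫ op21 (mulT V) M = V ◁ op21 (mulT V) M ≫ op21 (lcons V) M :=
  op21_assoc (op21_lcons_mulT V) M

/-- `TV` is associative. -/
lemma mulT_assoc [MonoidalPreadditive C] (V : C) :
    op21 (mulT V) (T V) ≫ mulT V = T V ◁ mulT V ≫ mulT V := by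
  -- Both triple products commute with left multiplication by a generator, so they solve the same
  -- homogeneous recursion.
  refine T_ext (lcons V) 0 ?_ ?_ ?_
  · rw [reassoc_of% @unitT_op21_mulT, ← whisker_exchange_assoc, unitT_mulT, leftUnitor_naturality]
  · rw [reassoc_of% @lcons_op21_mulT, op21_lcons_mulT]; simp
  · rw [reassoc_of% @op21_tail, op21_lcons_mulT]; simp

end TensorAlgebra

/-! ## The coproduct of the tensor algebra and its skew derivations -/

section Coproduct

variable {C : Type u} [Category.{v} C] [Abelian C] [MonoidalCategory C] [BraidedCategory C]
  [HasCoproductsOfShape ℕ C] [∀ X : C, PreservesColimitsOfShape (Discrete ℕ) (tensorLeft X)]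

/-- The counit of `TV`. -/
noncomputable def counitT (V : C) : T V ⟶ 𝟙_ C :=
  Sigma.desc fun n => match n with
    | 0 => (tnil V).inv
    | _ => 0

@[simp]
lemma inclT_zero_counitT (V : C) : inclT V 0 ≫ counitT V = (tnil V).inv := by
  simp [inclT, counitT]

@[simp]
lemma inclT_succ_counitT (V : C) (n : ℕ) : inclT V (n + 1) ≫ counitT V = 0 := by
  simp [inclT, counitT]

@[simp]
lemma inclT_one_projT (V : C) : inclT V 1 ≫ projT V = (tone V).inv := by
  simp [inclT, projT]

@[simp]
lemma inclT_zero_projT (V : C) : inclT V 0 ≫ projT V = 0 := by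
  simp [inclT, projT]

@[simp]
lemma inclT_add_two_projT (V : C) (n : ℕ) : inclT V (n + 2) ≫ projT V = 0 := by
  simp [inclT, projT]

@[simp]
lemma unitT_counitT (V : C) : unitT V ≫ counitT V = 𝟙 _ := by simp [unitT]

@[simp]
lemma unitT_projT (V : C) : unitT V ≫ projT V = 0 := by simp [unitT]

@[simp]
lemma lcons_counitT (V : C) : lcons V ≫ counitT V = 0 := by
  refine whiskerLeft_T_hom_ext fun n => ?_
  rw [reassoc_of% @incl_lcons]; simp

lemma genT_eq (V : C) : genT V = (ρ_ V).inv ≫ V ◁ unitT V ≫ lcons V := by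
  rw [unitT, whiskerLeft_comp, Category.assoc, incl_lcons]
  simp [genT, tone]

lemma genT_mulT (V : C) : genT V ▷ T V ≫ mulT V = lcons V := by
  rw [genT_eq, comp_whiskerRight, comp_whiskerRight, Category.assoc, Category.assoc, lcons_mulT,
    associator_naturality_middle_assoc, ← whiskerLeft_comp_assoc, unitT_mulT]
  monoidal

lemma unitT_coprodT (V : C) :
    unitT V ≫ coprodT V = (λ_ (𝟙_ C)).inv ≫ (unitT V ⊗ₘ unitT V) := by
  simp [unitT, coprodT, inclT, coprodPow]

variable [MonoidalPreadditive C]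

lemma lcons_projT (V : C) : lcons V ≫ projT V = V ◁ counitT V ≫ (ρ_ V).hom := by
  refine whiskerLeft_T_hom_ext fun n => ?_
  rw [reassoc_of% @incl_lcons, ← whiskerLeft_comp_assoc]
  cases n with
  | zero => simp [tone]
  | succ n => simp

lemma mulT_unitT (V : C) : T V ◁ unitT V ≫ mulT V = (ρ_ (T V)).hom := by
  refine T_ext (lcons V) 0 ?_ ?_ ?_
  · rw [← whisker_exchange_assoc, unitT_mulT, rightUnitor_naturality, leftUnitor_naturality,
      unitors_equal]
  · rw [reassoc_of% @op21_tail]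
    rw [op21_lcons_mulT, whiskerLeft_comp, Category.assoc, add_zero]
  · rw [op21, Category.assoc, rightUnitor_naturality, add_zero]
    monoidal

/-- In $(v\otimes1+1\otimes v)(a\otimes b)$ the first summand multiplies $a$ by $v$, since crossing
the unit is trivial; in the second, $v$ must be braided past $a$ before it multiplies $b$. -/
lemma primT_mul (V : C) :
    primT V ▷ (T V ⊗ T V) ≫ tensorμ (T V) (T V) (T V) (T V) ≫ (mulT V ⊗ₘ mulT V) =
      op21 (lcons V) (T V) + br V (T V) (T V) ≫ T V ◁ lcons V := by
  rw [primT, MonoidalPreadditive.add_whiskerRight, Preadditive.add_comp]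
  congr 1
  · have h : (genT V ⊗ₘ unitT V) ▷ (T V ⊗ T V) ≫ tensorμ (T V) (T V) (T V) (T V) =
        tensorμ V (𝟙_ C) (T V) (T V) ≫ (genT V ▷ T V ⊗ₘ unitT V ▷ T V) := by
      have := tensorμ_natural (genT V) (unitT V) (𝟙 (T V)) (𝟙 (T V))
      simpa using this
    rw [comp_whiskerRight, Category.assoc, reassoc_of% h, tensorHom_comp_tensorHom,
      genT_mulT, unitT_mulT, tensorμ, braiding_tensorUnit_left, op21,
      MonoidalCategory.tensorHom_def]
    monoidal
  · have h : (unitT V ⊗ₘ genT V) ▷ (T V ⊗ T V) ≫ tensorμ (T V) (T V) (T V) (T V) =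
        tensorμ (𝟙_ C) V (T V) (T V) ≫ (unitT V ▷ T V ⊗ₘ genT V ▷ T V) := by
      have := tensorμ_natural (unitT V) (genT V) (𝟙 (T V)) (𝟙 (T V))
      simpa using this
    rw [comp_whiskerRight, Category.assoc, reassoc_of% h, tensorHom_comp_tensorHom,
      genT_mulT, unitT_mulT, tensorμ, br,
      MonoidalCategory.tensorHom_def]
    monoidal

lemma lcons_coprodT (V : C) :
    lcons V ≫ coprodT V =
      V ◁ coprodT V ≫ (op21 (lcons V) (T V) + br V (T V) (T V) ≫ T V ◁ lcons V) := by
  refine whiskerLeft_T_hom_ext fun n => ?_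
  have h : ∀ n, inclT V n ≫ coprodT V = coprodPow V n := fun n => by simp [inclT, coprodT]
  rw [reassoc_of% @incl_lcons, h, ← whiskerLeft_comp_assoc, h, coprodPow, Iso.hom_inv_id_assoc,
    MonoidalCategory.tensorHom_def', Category.assoc, primT_mul]

lemma coprodT_counitT_left (V : C) :
    coprodT V ≫ counitT V ▷ T V = (λ_ (T V)).inv := by
  rw [← cancel_mono (λ_ (T V)).hom, Iso.inv_hom_id, Category.assoc]
  refine T_ext_of_recursion (lcons V) 0 ?_ ?_ ?_
  · rw [reassoc_of% @unitT_coprodT, MonoidalCategory.tensorHom_def', Category.assoc,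
      ← comp_whiskerRight_assoc, unitT_counitT]
    simp
  · rw [reassoc_of% @lcons_coprodT, Preadditive.add_comp, ← reassoc_of% @op21_comp, lcons_counitT]
    simp only [Category.assoc, whisker_exchange_assoc, add_zero]
    have h0 : op21 (0 : V ⊗ T V ⟶ 𝟙_ C) (T V) = 0 := by simp [op21]
    rw [h0, zero_comp, zero_add]
    rw [leftUnitor_naturality, ← reassoc_of% @br_naturality_right, reassoc_of% @br_unit_right]
    simp
  · simp

lemma coprodT_counitT_right (V : C) :
    coprodT V ≫ T V ◁ counitT V = (ρ_ (T V)).inv := by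
  rw [← cancel_mono (ρ_ (T V)).hom, Iso.inv_hom_id, Category.assoc]
  refine T_ext_of_recursion (lcons V) 0 ?_ ?_ ?_
  · rw [reassoc_of% @unitT_coprodT, MonoidalCategory.tensorHom_def, Category.assoc,
      ← whiskerLeft_comp_assoc, unitT_counitT]
    simp [unitors_inv_equal]
  · rw [reassoc_of% @lcons_coprodT, Preadditive.add_comp, Category.assoc,
      ← whiskerLeft_comp_assoc (T V),
      lcons_counitT, MonoidalPreadditive.whiskerLeft_zero]
    simp only [comp_zero, zero_comp, add_zero]
    rw [reassoc_of% @op21_tail, op21]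
    simp only [whiskerLeft_comp, Category.assoc, rightUnitor_naturality]
    monoidal
  · simp

/-- The component `TV ⟶ V ⊗ TV` of the coproduct. -/
noncomputable def leftD (V : C) : T V ⟶ V ⊗ T V := coprodT V ≫ projT V ▷ T V

/-- The component `TV ⟶ TV ⊗ V` of the coproduct. -/
noncomputable def rightD (V : C) : T V ⟶ T V ⊗ V := coprodT V ≫ T V ◁ projT V

@[simp]
lemma unitT_leftD (V : C) : unitT V ≫ leftD V = 0 := by
  rw [leftD, reassoc_of% @unitT_coprodT, MonoidalCategory.tensorHom_def', Category.assoc,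
    ← comp_whiskerRight, unitT_projT]
  simp

@[simp]
lemma unitT_rightD (V : C) : unitT V ≫ rightD V = 0 := by
  rw [rightD, reassoc_of% @unitT_coprodT, MonoidalCategory.tensorHom_def, Category.assoc,
    ← whiskerLeft_comp, unitT_projT]
  simp

/-- Project the first factor of $\Delta(vx)$ to degree one. In the term $vx_1\otimes x_2$ only a
scalar $x_1$ survives, and the counit law leaves $v\otimes x$. In the other term $v$ crosses $x_1$,
so projecting $x_1$ first gives $\Psi_{12}$ followed by multiplication. -/
lemma lcons_leftD (V : C) :
    lcons V ≫ leftD V = V ◁ leftD V ≫ br V V (T V) ≫ V ◁ lcons V + 𝟙 _ := by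
  rw [leftD, reassoc_of% @lcons_coprodT, Preadditive.add_comp, Preadditive.comp_add, add_comm]
  congr 1
  · rw [Category.assoc, whisker_exchange, whiskerLeft_comp, Category.assoc,
      reassoc_of% @br_naturality_right]
  · rw [← op21_comp, lcons_projT, op21_whiskerLeft_comp, ← whiskerLeft_comp_assoc,
      coprodT_counitT_left, op21]
    monoidal

lemma lcons_rightD (V : C) :
    lcons V ≫ rightD V = V ◁ rightD V ≫ op21 (lcons V) V + (β_ V (T V)).hom := by
  rw [rightD, reassoc_of% @lcons_coprodT, Preadditive.add_comp, Preadditive.comp_add]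
  congr 1
  · rw [op21_tail, whiskerLeft_comp_assoc]
  · rw [Category.assoc, ← whiskerLeft_comp, lcons_projT, whiskerLeft_comp,
      ← Category.assoc (br _ _ _),
      br_tail, Category.assoc, ← whiskerLeft_comp_assoc, coprodT_counitT_right, br]
    monoidal

end Coproduct

section Calculus

variable {C : Type u} [Category.{v} C] [MonoidalCategory C]

lemma op21_op12 {X Y Z U W : C} (f : X ⊗ Y ⟶ Z) (g : Z ⟶ U ⊗ W) (M : C) :
    op21 f M ≫ op12 g M = (α_ X Y M).inv ≫ (f ≫ g) ▷ M ≫ (α_ U W M).hom := by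
  simp [op21, op12]

variable [BraidedCategory C]

lemma op12_braiding (X : C) {W Y Z : C} (f : W ⟶ Y ⊗ Z) :
    (β_ X W).hom ≫ op12 f X = X ◁ f ≫ br X Y Z ≫ Y ◁ (β_ X Z).hom := by
  rw [op12, ← BraidedCategory.braiding_naturality_right_assoc,
    BraidedCategory.braiding_tensor_right_hom, br]
  simp

end Calculus

/-! ### Leibniz rules, commutation and squares of the skew derivations -/

section SkewDerivations

variable {C : Type u} [Category.{v} C] [Abelian C] [MonoidalCategory C] [BraidedCategory C]
  [HasCoproductsOfShape ℕ C] [∀ X : C, PreservesColimitsOfShape (Discrete ℕ) (tensorLeft X)]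
  [MonoidalPreadditive C]

lemma op21_lcons_op12_leftD (V M : C) :
    op21 (lcons V) M ≫ op12 (leftD V) M =
      V ◁ op12 (leftD V) M ≫ br V V (T V ⊗ M) ≫ V ◁ op21 (lcons V) M + 𝟙 _ := by
  rw [op21_op12, lcons_leftD, MonoidalPreadditive.add_whiskerRight, Preadditive.add_comp,
    Preadditive.comp_add]
  congr 1
  · simp only [br, op12, op21]
    monoidal
  · simp

lemma op21_lcons_op12_rightD (V M : C) :
    op21 (lcons V) M ≫ op12 (rightD V) M =
      V ◁ op12 (rightD V) M ≫ op21 (lcons V) (V ⊗ M) + br V (T V) M := by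
  rw [op21_op12, lcons_rightD, MonoidalPreadditive.add_whiskerRight, Preadditive.add_comp,
    Preadditive.comp_add]
  congr 1
  simp only [op12, op21]
  monoidal

/-- `leftD` is a braided derivation: `D(ab) = D(a) b + Ψ(a ⊗ b₁) b₂` for `D b = b₁ ⊗ b₂`. -/
lemma mulT_leftD (V M : C) :
    op21 (mulT V) M ≫ op12 (leftD V) M =
      op12 (leftD V) (T V ⊗ M) ≫ V ◁ op21 (mulT V) M +
        T V ◁ op12 (leftD V) M ≫ br (T V) V (T V ⊗ M) ≫ V ◁ op21 (mulT V) M := by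
  -- The recursion is the one for $D$ in the left factor $a$: the inhomogeneous term is $v\otimes
  -- ab$, coming from the summand $v\otimes x$ of $D(vx)$.
  refine T_ext (br V V (T V ⊗ M) ≫ V ◁ op21 (lcons V) M) (V ◁ op21 (mulT V) M) ?_ ?_ ?_
  · rw [reassoc_of% @unitT_op21_mulT, Preadditive.comp_add, ← reassoc_of% @op12_comp, unitT_leftD,
      ← whisker_exchange_assoc, reassoc_of% @br_naturality_left, ← whiskerLeft_comp,
      unitT_op21_mulT,
      br_unit_left]
    simp [op12]
  · rw [reassoc_of% @lcons_op21_mulT, op21_lcons_op12_leftD]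
    simp
  · rw [Preadditive.comp_add, reassoc_of% @op21_lcons_op12_leftD, reassoc_of% @op21_tail,
      reassoc_of% @op21_br_left]
    simp only [Preadditive.add_comp, Category.assoc, Category.id_comp, ← whiskerLeft_comp,
      lcons_op21_mulT]
    simp only [whiskerLeft_comp, reassoc_of% @br_tail, Category.assoc,
      MonoidalPreadditive.whiskerLeft_add, Preadditive.add_comp]
    abel

/-- `rightD` is a braided derivation: `D(ab) = a D(b) + a₁ Ψ(a₂ ⊗ b)` for `D a = a₁ ⊗ a₂`. -/
lemma mulT_rightD (V M : C) :
    op21 (mulT V) M ≫ op12 (rightD V) M =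
      T V ◁ op12 (rightD V) M ≫ op21 (mulT V) (V ⊗ M) +
        op12 (rightD V) (T V ⊗ M) ≫ T V ◁ br V (T V) M ≫ op21 (mulT V) (V ⊗ M) := by
  refine T_ext (op21 (lcons V) (V ⊗ M)) (V ◁ op21 (mulT V) M ≫ br V (T V) M) ?_ ?_ ?_
  · rw [reassoc_of% @unitT_op21_mulT, Preadditive.comp_add, ← reassoc_of% @op12_comp, unitT_rightD,
      ← whisker_exchange_assoc, unitT_op21_mulT]
    simp [op12]
  · rw [reassoc_of% @lcons_op21_mulT, op21_lcons_op12_rightD]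
    simp
  · rw [Preadditive.comp_add, reassoc_of% @op21_lcons_op12_rightD, reassoc_of% @op21_tail,
      lcons_op21_mulT,
      Preadditive.add_comp, Category.assoc, reassoc_of% @op21_tail, lcons_op21_mulT, op21_br_right]
    simp only [MonoidalPreadditive.whiskerLeft_add, Preadditive.add_comp, whiskerLeft_comp,
      Category.assoc]
    abel

/-- Coassociativity, projected to degree 1 in the first factor. -/
lemma coprodT_leftD (V : C) :
    coprodT V ≫ op12 (leftD V) (T V) = leftD V ≫ V ◁ coprodT V := by
  refine T_ext_of_recursion (br V V (T V ⊗ T V) ≫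
    V ◁ (op21 (lcons V) (T V) + br V (T V) (T V) ≫ T V ◁ lcons V)) (V ◁ coprodT V) ?_ ?_ ?_
  · rw [reassoc_of% @unitT_leftD, reassoc_of% @unitT_coprodT, MonoidalCategory.tensorHom_def',
      Category.assoc,
      ← op12_comp, unitT_leftD]
    simp [op12]
  · rw [reassoc_of% @lcons_coprodT, Preadditive.add_comp, op21_lcons_op12_leftD, Category.assoc,
      ← op12_tail, ← reassoc_of% @op12_br_right]
    simp only [MonoidalPreadditive.whiskerLeft_add, whiskerLeft_comp, Category.assoc,
      Preadditive.comp_add, Category.comp_id]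
    abel
  · rw [reassoc_of% @lcons_leftD, Preadditive.add_comp, Category.assoc, Category.assoc,
      ← whiskerLeft_comp, lcons_coprodT, whiskerLeft_comp, reassoc_of% @br_tail]
    simp

/-- Both sides are the component of the iterated coproduct with first and last factors of degree
one, so coassociativity in the form `coprodT_leftD` suffices. -/
lemma leftD_rightD (V : C) :
    rightD V ≫ op12 (leftD V) V = leftD V ≫ V ◁ rightD V := by
  rw [rightD, Category.assoc, ← op12_tail, reassoc_of% @coprodT_leftD, whiskerLeft_comp]

/-- Two applications of `leftD` agree with a map composed with `id + Ψ`. -/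
lemma leftD_leftD (V : C) {W : C} (Q : V ⊗ V ⟶ W) (hQ : (β_ V V).hom ≫ Q + Q = 0) :
    leftD V ≫ V ◁ leftD V ≫ op21 Q (T V) = 0 := by
  have hQ' : br V V (T V) ≫ op21 Q (T V) + op21 Q (T V) = 0 := by
    have := congrArg (fun f => (α_ V V (T V)).inv ≫ f ▷ T V) hQ
    simpa [br, op21] using this
  refine T_ext_of_recursion (br V W (T V) ≫ W ◁ lcons V) 0 ?_ ?_ ?_
  · simp [reassoc_of% @unitT_leftD]
  · rw [reassoc_of% @lcons_leftD, Preadditive.add_comp]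
    simp only [Category.assoc, Category.id_comp]
    rw [← whiskerLeft_comp_assoc V (lcons V), lcons_leftD]
    simp only [MonoidalPreadditive.whiskerLeft_add, whiskerLeft_comp, Category.assoc,
      Preadditive.add_comp, Preadditive.comp_add, whiskerLeft_id, Category.id_comp,
      ← op21_tail, reassoc_of% @br_tail, add_zero, reassoc_of% @op21_br_right]
    -- Applying $D$ twice to $vx$ leaves, besides the recursive term, $v\otimes Dx$ once directly
    -- and once after $\Psi_{12}$; these cancel because $Q\Psi=-Q$.
    rw [add_assoc, ← Preadditive.comp_add, hQ', comp_zero, add_zero]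
  · simp

/-- The mirror image of `leftD_leftD`: when $D'$ is applied twice to $vx$, the letter $v$ reaches
either of the two outer places on the right. The two terms differ by one $\Psi$ and cancel under
$Q$, leaving a homogeneous recursion. -/
lemma rightD_rightD (V : C) {W : C} (Q : V ⊗ V ⟶ W) (hQ : (β_ V V).hom ≫ Q + Q = 0) :
    rightD V ≫ op12 (rightD V) V ≫ T V ◁ Q = 0 := by
  have hQ' : br V (T V) V ≫ T V ◁ Q + br V (T V) V ≫ T V ◁ (β_ V V).hom ≫ T V ◁ Q = 0 := by
    rw [← Preadditive.comp_add, ← whiskerLeft_comp, ← MonoidalPreadditive.whiskerLeft_add,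
      add_comm Q, hQ]
    simp
  refine T_ext_of_recursion (op21 (lcons V) W) 0 ?_ ?_ ?_
  · simp [reassoc_of% @unitT_rightD]
  · rw [reassoc_of% @lcons_rightD, Preadditive.add_comp, reassoc_of% @op12_braiding, Category.assoc,
      reassoc_of% @op21_lcons_op12_rightD, Preadditive.add_comp, Preadditive.comp_add,
      Category.assoc,
      op21_tail, add_assoc, ← Preadditive.comp_add, hQ']
    simp
  · simp

end SkewDerivations

/-! ## Exactness of the tensor product -/

section Exactness

variable {C : Type u} [Category.{v} C] [Abelian C] [MonoidalCategory C] [BraidedCategory C]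
  [∀ X : C, PreservesFiniteColimits (tensorLeft X)]

instance preservesFiniteColimits_tensorRight (X : C) : PreservesFiniteColimits (tensorRight X) :=
  preservesFiniteColimits_of_natIso (BraidedCategory.tensorLeftIsoTensorRight X)

instance epi_whiskerRight {X Y : C} (f : X ⟶ Y) [Epi f] (Z : C) : Epi (f ▷ Z) :=
  inferInstanceAs (Epi ((tensorRight Z).map f))

instance epi_whiskerLeft {X Y : C} (f : X ⟶ Y) [Epi f] (Z : C) : Epi (Z ◁ f) :=
  inferInstanceAs (Epi ((tensorLeft Z).map f))

instance epi_tensorHom {X Y X' Y' : C} (f : X ⟶ Y) (g : X' ⟶ Y') [Epi f] [Epi g] :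
    Epi (f ⊗ₘ g) := by
  rw [MonoidalCategory.tensorHom_def]; infer_instance

variable [MonoidalPreadditive C]

lemma exists_whiskerRight_cokernel_desc {K A Z : C} (k : K ⟶ A) (X : C) (f : A ⊗ X ⟶ Z)
    (h : k ▷ X ≫ f = 0) : ∃ g, cokernel.π k ▷ X ≫ g = f :=
  ⟨(PreservesCokernel.iso (tensorRight X) k).hom ≫ cokernel.desc ((tensorRight X).map k) f h, by
    have : cokernel.π k ▷ X ≫ (PreservesCokernel.iso (tensorRight X) k).hom = _ :=
      PreservesCokernel.π_iso_hom (tensorRight X) k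
    rw [reassoc_of% this]
    exact cokernel.π_desc _ _ _⟩

lemma exists_whiskerLeft_cokernel_desc {K A Z : C} (k : K ⟶ A) (X : C) (f : X ⊗ A ⟶ Z)
    (h : X ◁ k ≫ f = 0) : ∃ g, X ◁ cokernel.π k ≫ g = f :=
  ⟨(PreservesCokernel.iso (tensorLeft X) k).hom ≫ cokernel.desc ((tensorLeft X).map k) f h, by
    have : X ◁ cokernel.π k ≫ (PreservesCokernel.iso (tensorLeft X) k).hom = _ :=
      PreservesCokernel.π_iso_hom (tensorLeft X) k
    rw [reassoc_of% this]
    exact cokernel.π_desc _ _ _⟩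

/-- A morphism factors through a tensor product of cokernels if it kills both kinds of relations. -/
lemma exists_tensorHom_cokernel_desc {K A L B' Z : C} (k : K ⟶ A) (l : L ⟶ B') (f : A ⊗ B' ⟶ Z)
    (hk : k ▷ B' ≫ f = 0) (hl : A ◁ l ≫ f = 0) : ∃ g, (cokernel.π k ⊗ₘ cokernel.π l) ≫ g = f := by
  obtain ⟨g, hg⟩ := exists_whiskerRight_cokernel_desc k B' f hk
  obtain ⟨g', hg'⟩ := exists_whiskerLeft_cokernel_desc l (cokernel k) g (by
    -- The second set of relations is tested upstairs, on $A\otimes L$, which covers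
    -- $\mathrm{coker}(k)\otimes L$ by right exactness.
    rw [← cancel_epi (cokernel.π k ▷ L), ← whisker_exchange_assoc, hg, hl, comp_zero])
  exact ⟨g', by rw [MonoidalCategory.tensorHom_def, Category.assoc, hg', hg]⟩

variable [∀ X : C, PreservesFiniteLimits (tensorLeft X)]

instance preservesFiniteLimits_tensorRight (X : C) : PreservesFiniteLimits (tensorRight X) :=
  preservesFiniteLimits_of_natIso (BraidedCategory.tensorLeftIsoTensorRight X)

instance mono_whiskerRight {X Y : C} (f : X ⟶ Y) [Mono f] (Z : C) : Mono (f ▷ Z) :=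
  inferInstanceAs (Mono ((tensorRight Z).map f))

instance mono_whiskerLeft {X Y : C} (f : X ⟶ Y) [Mono f] (Z : C) : Mono (Z ◁ f) :=
  inferInstanceAs (Mono ((tensorLeft Z).map f))

instance mono_tensorHom {X Y X' Y' : C} (f : X ⟶ Y) (g : X' ⟶ Y') [Mono f] [Mono g] :
    Mono (f ⊗ₘ g) := by
  rw [MonoidalCategory.tensorHom_def]; infer_instance

/-- If `a'` and `b'` vanish on the kernels of `a` and `b`, then `a' ⊗ b'` vanishes on the kernel of
`a ⊗ b`. -/
lemma comp_tensorHom_eq_zero {K A B' A₁ B₁ A₂ B₂ : C} (g : K ⟶ A ⊗ B') (a : A ⟶ A₁) (b : B' ⟶ B₁)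
    (a' : A ⟶ A₂) (b' : B' ⟶ B₂) (hg : g ≫ (a ⊗ₘ b) = 0) (ha : kernel.ι a ≫ a' = 0)
    (hb : kernel.ι b ≫ b' = 0) : g ≫ (a' ⊗ₘ b') = 0 := by
  -- Each of $a,b$ is a quotient onto its coimage followed by a monomorphism. A tensor product of
  -- monomorphisms is mono, so $g$ already dies in the tensor product of the coimages, and
  -- $a'\otimes b'$ factors through that object.
  rw [← Abelian.coimage.fac a, ← Abelian.coimage.fac b, ← tensorHom_comp_tensorHom,
    ← Category.assoc] at hg
  have h := zero_of_comp_mono _ hg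
  rw [← cokernel.π_desc (kernel.ι a) a' ha, ← cokernel.π_desc (kernel.ι b) b' hb,
    ← tensorHom_comp_tensorHom, ← Category.assoc]
  exact (congrArg (· ≫ _) h).trans zero_comp

end Exactness

/-! ## The quotient `B₊(V)` of the tensor algebra -/

section Quotient

variable {C : Type u} [Category.{v} C] [Abelian C] [MonoidalCategory C] [BraidedCategory C]
  [HasCoproductsOfShape ℕ C] [∀ X : C, PreservesColimitsOfShape (Discrete ℕ) (tensorLeft X)]
  [MonoidalPreadditive C]

instance (V : C) (n : ℕ) : Mono (inclT V n) := by
  classical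
  exact mono_of_mono_fac (Sigma.ι_π_eq_id (f := tpow V) n)

instance (V : C) : Epi (quotB V) := by unfold quotB; infer_instance

lemma kernel_inclT_quotB (V : C) (n : ℕ) :
    kernel.ι (braidedFactorial V n) ≫ inclT V n ≫ quotB V = 0 := by
  have h : Sigma.ι _ n ≫ (Limits.Sigma.map fun n => kernel.ι (braidedFactorial V n)) ≫
      quotB V = 0 := by
    rw [quotB, cokernel.condition, comp_zero]
  simpa [inclT] using h

lemma comp_inclT_quotB_eq_zero {V X : C} {n : ℕ} (f : X ⟶ tpow V n)
    (h : f ≫ braidedFactorial V n = 0) : f ≫ inclT V n ≫ quotB V = 0 := by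
  rw [← kernel.lift_ι _ f h, Category.assoc, kernel_inclT_quotB, comp_zero]

/-- The component `V^{⊗(n+1)} ⟶ V ⊗ V^{⊗n}` of the coproduct. -/
noncomputable def leftDPow (V : C) (n : ℕ) : tpow V (n + 1) ⟶ V ⊗ tpow V n :=
  braidedInt V (n + 1) ≫ (tcons V n).inv

lemma braidedFactorial_succ (V : C) (n : ℕ) :
    braidedFactorial V (n + 1) =
      leftDPow V n ≫ V ◁ braidedFactorial V n ≫ (tcons V n).hom := by
  simp [braidedFactorial, leftDPow, tail]

lemma inclT_zero_eq (V : C) : inclT V 0 = (tnil V).inv ≫ unitT V := by simp [unitT]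

lemma inclT_succ_eq (V : C) (n : ℕ) :
    inclT V (n + 1) = (tcons V n).inv ≫ V ◁ inclT V n ≫ lcons V := by
  rw [incl_lcons]; simp

lemma inclT_zero_leftD (V : C) : inclT V 0 ≫ leftD V = 0 := by
  rw [inclT_zero_eq, Category.assoc, unitT_leftD, comp_zero]

/-- The recursion `lcons_leftD` is exactly
$[n+2,\Psi]=\mathrm{id}+\Psi_{12}(\mathrm{id}\otimes[n+1,\Psi])$. This is the link between the
coproduct and the ideal defining $B$. -/
lemma inclT_succ_leftD (V : C) (n : ℕ) :
    inclT V (n + 1) ≫ leftD V = leftDPow V n ≫ V ◁ inclT V n := by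
  induction n with
  | zero =>
    rw [inclT_succ_eq, Category.assoc, Category.assoc, lcons_leftD, Preadditive.comp_add,
      ← whiskerLeft_comp_assoc, inclT_zero_leftD]
    simp [leftDPow, braidedInt]
  | succ n ih =>
    rw [inclT_succ_eq, Category.assoc, Category.assoc, lcons_leftD, Preadditive.comp_add,
      ← whiskerLeft_comp_assoc, ih, whiskerLeft_comp, Category.assoc, ← reassoc_of% @br_tail,
      ← whiskerLeft_comp, incl_lcons]
    simp only [leftDPow, braidedInt, tail, braidFirst, br, Preadditive.comp_add,
      Preadditive.add_comp, Category.assoc, whiskerLeft_comp, Iso.hom_inv_id_assoc,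
      Iso.hom_inv_id, Category.comp_id, Category.id_comp]
    abel

/-- The braided factorials, as an endomorphism of `TV`. -/
noncomputable def factT (V : C) : T V ⟶ T V := Limits.Sigma.map (braidedFactorial V)

lemma inclT_factT (V : C) (n : ℕ) : inclT V n ≫ factT V = braidedFactorial V n ≫ inclT V n := by
  simp [inclT, factT]

/-- The recursion $[n+1,\Psi]!=(\mathrm{id}\otimes[n,\Psi]!)[n+1,\Psi]$ for all degrees at once,
with the braided integer read as $D$; the counit term accounts for degree zero. -/
lemma factT_eq (V : C) :
    factT V = counitT V ≫ unitT V + leftD V ≫ V ◁ factT V ≫ lcons V := by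
  refine T_hom_ext fun n => ?_
  rw [inclT_factT, Preadditive.comp_add]
  cases n with
  | zero =>
    rw [reassoc_of% @inclT_zero_leftD, reassoc_of% @inclT_zero_counitT]
    simp [braidedFactorial, inclT_zero_eq]
  | succ n =>
    rw [reassoc_of% @inclT_succ_leftD, reassoc_of% @inclT_succ_counitT, ← whiskerLeft_comp_assoc,
      inclT_factT,
      whiskerLeft_comp, Category.assoc, incl_lcons, braidedFactorial_succ]
    simp

/-- The tailed Leibniz rule with the unit object as tail; whiskering by the unit loses no
information. -/
lemma mulT_leftD_untailed (V : C) :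
    mulT V ≫ leftD V = leftD V ▷ T V ≫ (α_ _ _ _).hom ≫ V ◁ mulT V +
      T V ◁ leftD V ≫ br (T V) V (T V) ≫ V ◁ mulT V := by
  have h := mulT_leftD V (𝟙_ C)
  rw [op21_op12] at h
  have h2 : op12 (leftD V) (T V ⊗ 𝟙_ C) ≫ V ◁ op21 (mulT V) (𝟙_ C) +
      T V ◁ op12 (leftD V) (𝟙_ C) ≫ br (T V) V (T V ⊗ 𝟙_ C) ≫ V ◁ op21 (mulT V) (𝟙_ C) =
      (α_ (T V) (T V) (𝟙_ C)).inv ≫ (leftD V ▷ T V ≫ (α_ _ _ _).hom ≫ V ◁ mulT V +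
      T V ◁ leftD V ≫ br (T V) V (T V) ≫ V ◁ mulT V) ▷ (𝟙_ C) ≫ (α_ V (T V) (𝟙_ C)).hom := by
    rw [MonoidalPreadditive.add_whiskerRight, Preadditive.add_comp, Preadditive.comp_add]
    congr 1
    · simp only [op12, op21]; monoidal
    · simp only [op12, op21, br]; monoidal
  rw [h2, Iso.cancel_iso_inv_left, Iso.cancel_iso_hom_right] at h
  exact (whiskerRight_iff _ _).1 h

/-- The braided factorials intertwine the product of `TV` with a (braided shuffle) product. -/
lemma exists_shuffle (V : C) (N m n : ℕ) (hN : m + n = N) :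
    ∃ s : tpow V m ⊗ tpow V n ⟶ T V, (inclT V m ⊗ₘ inclT V n) ≫ mulT V ≫ factT V =
      (braidedFactorial V m ⊗ₘ braidedFactorial V n) ≫ s := by
  induction N using Nat.strong_induction_on generalizing m n with
  | _ N ih =>
  rcases m with - | m
  · refine ⟨(tnil V).inv ▷ _ ≫ (λ_ _).hom ≫ inclT V n, ?_⟩
    have h : (inclT V 0 ⊗ₘ inclT V n) ≫ mulT V =
        (tnil V).inv ▷ tpow V n ≫ (λ_ _).hom ≫ inclT V n := by
      rw [MonoidalCategory.tensorHom_def', inclT_zero_eq, Category.assoc, comp_whiskerRight,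
        Category.assoc, unitT_mulT, whisker_exchange_assoc, leftUnitor_naturality]
    rw [reassoc_of% h, inclT_factT, ← leftUnitor_naturality_assoc, ← whisker_exchange_assoc,
      MonoidalCategory.tensorHom_def', Category.assoc]
    simp [braidedFactorial]
  rcases n with - | n
  · refine ⟨_ ◁ (tnil V).inv ≫ (ρ_ _).hom ≫ inclT V (m + 1), ?_⟩
    have h : (inclT V (m + 1) ⊗ₘ inclT V 0) ≫ mulT V =
        tpow V (m + 1) ◁ (tnil V).inv ≫ (ρ_ _).hom ≫ inclT V (m + 1) := by
      rw [MonoidalCategory.tensorHom_def, inclT_zero_eq, Category.assoc, whiskerLeft_comp,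
        Category.assoc, mulT_unitT, ← whisker_exchange_assoc, rightUnitor_naturality]
    rw [reassoc_of% h, inclT_factT, ← rightUnitor_naturality_assoc, whisker_exchange_assoc,
      MonoidalCategory.tensorHom_def, Category.assoc]
    simp [braidedFactorial]
  -- By the Leibniz rule, $D$ takes its letter either from the left word or from the right one,
  -- hence the two smaller cases. The resulting $s$ is a sum over the origin of the first letter,
  -- braided past the left word when it comes from the right.
  obtain ⟨s, hs⟩ := ih (m + (n + 1)) (by omega) m (n + 1) rfl
  obtain ⟨s', hs'⟩ := ih (m + 1 + n) (by omega) (m + 1) n rfl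
  have hc : (inclT V (m + 1) ⊗ₘ inclT V (n + 1)) ≫ mulT V ≫ counitT V = 0 := by
    rw [reassoc_of% (incl_mulT V (m + 1) (n + 1))]
    have : inclT V (m + 1 + (n + 1)) ≫ counitT V = 0 := inclT_succ_counitT V (m + 1 + n)
    rw [this, comp_zero]
  refine ⟨(tcons V m).inv ▷ tpow V (n + 1) ≫ (α_ _ _ _).hom ≫ V ◁ s ≫ lcons V +
    tpow V (m + 1) ◁ (tcons V n).inv ≫ br (tpow V (m + 1)) V (tpow V n) ≫ V ◁ s' ≫ lcons V, ?_⟩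
  rw [factT_eq, Preadditive.comp_add, Preadditive.comp_add, reassoc_of% hc, zero_comp, zero_add,
    reassoc_of% (mulT_leftD_untailed V), Preadditive.comp_add, Preadditive.add_comp,
    Preadditive.comp_add]
  congr 1
  · have e1 : (inclT V (m + 1) ⊗ₘ inclT V (n + 1)) ≫ leftD V ▷ T V =
        leftDPow V m ▷ tpow V (n + 1) ≫ (V ◁ inclT V m ⊗ₘ inclT V (n + 1)) := by
      rw [MonoidalCategory.tensorHom_def', Category.assoc, ← comp_whiskerRight, inclT_succ_leftD,
        comp_whiskerRight, MonoidalCategory.tensorHom_def', whisker_exchange_assoc]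
    have e2 : (V ◁ inclT V m ⊗ₘ inclT V (n + 1)) ≫ (α_ V (T V) (T V)).hom =
        (α_ _ _ _).hom ≫ V ◁ (inclT V m ⊗ₘ inclT V (n + 1)) := by
      simp [MonoidalCategory.tensorHom_def]
    have e3 : (leftDPow V m ≫ V ◁ braidedFactorial V m) ▷ tpow V (n + 1) ≫
        (V ⊗ tpow V m) ◁ braidedFactorial V (n + 1) =
        (braidedFactorial V (m + 1) ⊗ₘ braidedFactorial V (n + 1)) ≫
          (tcons V m).inv ▷ tpow V (n + 1) := by
      rw [MonoidalCategory.tensorHom_def', Category.assoc, ← comp_whiskerRight,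
        braidedFactorial_succ V m, ← whisker_exchange]
      simp
    simp only [Category.assoc]
    rw [reassoc_of% e1, reassoc_of% e2, ← whiskerLeft_comp_assoc, ← whiskerLeft_comp_assoc,
      Category.assoc, hs, ← reassoc_of% e3]
    simp [MonoidalCategory.tensorHom_def]
  · have e1 : (inclT V (m + 1) ⊗ₘ inclT V (n + 1)) ≫ T V ◁ leftD V =
        tpow V (m + 1) ◁ leftDPow V n ≫ (inclT V (m + 1) ⊗ₘ V ◁ inclT V n) := by
      rw [MonoidalCategory.tensorHom_def, Category.assoc, ← whiskerLeft_comp, inclT_succ_leftD,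
        whiskerLeft_comp, MonoidalCategory.tensorHom_def, whisker_exchange_assoc]
    have e2 : ∀ {X Y X' Y' : C} (f : X ⟶ Y) (g : X' ⟶ Y'),
        (f ⊗ₘ V ◁ g) ≫ br Y V Y' = br X V X' ≫ V ◁ (f ⊗ₘ g) := by
      intro X Y X' Y' f g
      rw [MonoidalCategory.tensorHom_def', MonoidalCategory.tensorHom_def', Category.assoc,
        br_naturality_left, whiskerLeft_comp, reassoc_of% @br_tail]
    have e3 : tpow V (m + 1) ◁ leftDPow V n ≫
        (braidedFactorial V (m + 1) ⊗ₘ V ◁ braidedFactorial V n) =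
        (braidedFactorial V (m + 1) ⊗ₘ braidedFactorial V (n + 1)) ≫
          tpow V (m + 1) ◁ (tcons V n).inv := by
      rw [MonoidalCategory.tensorHom_def, MonoidalCategory.tensorHom_def,
        braidedFactorial_succ V n, whisker_exchange_assoc]
      simp
    simp only [Category.assoc]
    rw [reassoc_of% e1, reassoc_of% (e2 (inclT V (m + 1)) (inclT V n)), ← whiskerLeft_comp_assoc,
      ← whiskerLeft_comp_assoc, Category.assoc, hs', ← reassoc_of% e3,
      reassoc_of% (e2 (braidedFactorial V (m + 1)) (braidedFactorial V n)), whiskerLeft_comp_assoc]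

/-- The ideal property in the form needed for the product of $B$: by `exists_shuffle` the product of
$f$ is killed by $[m+n,\Psi]!$, so it vanishes in $B$. It is applied to a kernel in one factor
tensored with the identity of the other. -/
lemma inclT_tmul_mem (V : C) (m n : ℕ) {X : C} (f : X ⟶ tpow V m ⊗ tpow V n)
    (hf : f ≫ (braidedFactorial V m ⊗ₘ braidedFactorial V n) = 0) :
    f ≫ (inclT V m ⊗ₘ inclT V n) ≫ mulT V ≫ quotB V = 0 := by
  obtain ⟨s, hs⟩ := exists_shuffle V _ m n rfl
  rw [reassoc_of% (incl_mulT V m n)] at hs ⊢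
  rw [← Category.assoc]
  refine comp_inclT_quotB_eq_zero _ ?_
  rw [← cancel_mono (inclT V (m + n)), Category.assoc, Category.assoc, ← inclT_factT, hs,
    reassoc_of% hf, zero_comp, zero_comp]

section

variable [∀ X : C, PreservesFiniteLimits (tensorLeft X)]
  [∀ X : C, PreservesFiniteColimits (tensorLeft X)]

lemma quotB_mulB (V : C) : (quotB V ⊗ₘ quotB V) ≫ mulB V = mulT V ≫ quotB V := by
  refine comp_induced _ _ (exists_tensorHom_cokernel_desc _ _ _ ?_ ?_)
  · refine whiskerRight_sigma_hom_ext fun m => ?_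
    rw [comp_zero, ← comp_whiskerRight_assoc, Sigma.ι_map, comp_whiskerRight_assoc]
    refine whiskerLeft_T_hom_ext fun n => ?_
    have h := inclT_tmul_mem V m n (kernel.ι (braidedFactorial V m) ▷ tpow V n) (by
      rw [MonoidalCategory.tensorHom_def, ← comp_whiskerRight_assoc, kernel.condition]; simp)
    rw [comp_zero, ← h, MonoidalCategory.tensorHom_def', Category.assoc, whisker_exchange_assoc]
    rfl
  · refine whiskerLeft_sigma_hom_ext fun n => ?_
    rw [comp_zero, ← whiskerLeft_comp_assoc, Sigma.ι_map, whiskerLeft_comp_assoc]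
    refine whiskerRight_T_hom_ext fun m => ?_
    have h := inclT_tmul_mem V m n (tpow V m ◁ kernel.ι (braidedFactorial V n)) (by
      rw [MonoidalCategory.tensorHom_def', ← whiskerLeft_comp_assoc, kernel.condition]; simp)
    rw [comp_zero, ← h, MonoidalCategory.tensorHom_def, Category.assoc, ← whisker_exchange_assoc]
    rfl

lemma quotB_varpi (V : C) : quotB V ≫ varpi V = projT V := by
  refine comp_induced _ _ ⟨cokernel.desc _ (projT V) ?_, cokernel.π_desc _ _ _⟩
  refine Sigma.hom_ext _ _ fun n => ?_
  have h : kernel.ι (braidedFactorial V n) ≫ inclT V n ≫ projT V = 0 := by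
    rcases n with - | - | n
    · simp
    · have h1 : braidedFactorial V 1 = 𝟙 _ := by simp [braidedFactorial, braidedInt, tail]
      have h2 : kernel.ι (braidedFactorial V 1) = 0 := by
        rw [← Category.comp_id (kernel.ι (braidedFactorial V 1))]
        conv_lhs => rw [← h1]
        exact kernel.condition _
      simp [h2]
    · simp
  simpa [inclT] using h

end

end Quotient

/-! ### Descent of the coproduct to $B$ -/

section CoproductB

variable {C : Type u} [Category.{v} C] [Abelian C] [MonoidalCategory C] [BraidedCategory C]
  [HasCoproductsOfShape ℕ C] [∀ X : C, PreservesColimitsOfShape (Discrete ℕ) (tensorLeft X)]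
  [MonoidalPreadditive C]

/-- The coproduct maps the kernel of a braided factorial to the kernel of a tensor product of
braided factorials. -/
lemma exists_deconcatenation (V : C) (n : ℕ) :
    ∃ G : tpow V n ⟶ T V ⊗ T V,
      inclT V n ≫ coprodT V ≫ (factT V ⊗ₘ factT V) = braidedFactorial V n ≫ G := by
  -- Expand $F$ in the first tensor factor by `factT_eq`. The counit part gives $1\otimes Fx$; in
  -- the other part coassociativity moves $D$ in front of $\Delta$, so that $(F\otimes F)\Delta$
  -- recurs one degree lower.
  have key : coprodT V ≫ (factT V ⊗ₘ factT V) = factT V ≫ (λ_ (T V)).inv ≫ unitT V ▷ T V +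
      leftD V ≫ V ◁ (coprodT V ≫ (factT V ⊗ₘ factT V)) ≫ op21 (lcons V) (T V) := by
    have h1 : coprodT V ≫ (leftD V ≫ V ◁ factT V ≫ lcons V) ▷ T V ≫ T V ◁ factT V =
        leftD V ≫ V ◁ (coprodT V ≫ (factT V ⊗ₘ factT V)) ≫ op21 (lcons V) (T V) := by
      rw [whiskerLeft_comp, Category.assoc, ← reassoc_of% @coprodT_leftD,
        MonoidalCategory.tensorHom_def,
        whiskerLeft_comp, Category.assoc, ← op21_tail]
      simp [op12, op21]
    have h2 : coprodT V ≫ (counitT V ≫ unitT V) ▷ T V ≫ T V ◁ factT V =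
        factT V ≫ (λ_ (T V)).inv ≫ unitT V ▷ T V := by
      rw [comp_whiskerRight, Category.assoc, reassoc_of% @coprodT_counitT_left, ← whisker_exchange,
        leftUnitor_inv_naturality_assoc]
    rw [← h1, ← h2, ← Preadditive.comp_add, ← Preadditive.add_comp,
      ← MonoidalPreadditive.add_whiskerRight, ← factT_eq, MonoidalCategory.tensorHom_def]
  induction n with
  | zero => exact ⟨_, by rw [braidedFactorial, Category.id_comp]⟩
  | succ n ih =>
    obtain ⟨G, hG⟩ := ih
    refine ⟨inclT V (n + 1) ≫ (λ_ (T V)).inv ≫ unitT V ▷ T V +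
      (tcons V n).inv ≫ V ◁ G ≫ op21 (lcons V) (T V), ?_⟩
    rw [key, Preadditive.comp_add, Preadditive.comp_add, reassoc_of% @inclT_factT,
      reassoc_of% @inclT_succ_leftD, ← whiskerLeft_comp_assoc, hG, braidedFactorial_succ]
    simp

lemma tensorHom_op21 {V A A' Z B B' : C} (a : A ⟶ A') (b : B ⟶ B') (f : V ⊗ A' ⟶ Z) :
    V ◁ (a ⊗ₘ b) ≫ op21 f B' = (α_ V A B).inv ≫ ((V ◁ a ≫ f) ⊗ₘ b) := by
  simp [MonoidalCategory.tensorHom_def', op21]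

lemma tensorHom_br {V A A' Z B B' : C} (a : A ⟶ A') (b : B ⟶ B') (f : V ⊗ B' ⟶ Z) :
    V ◁ (a ⊗ₘ b) ≫ br V A' B' ≫ A' ◁ f = br V A B ≫ (a ⊗ₘ (V ◁ b ≫ f)) := by
  rw [MonoidalCategory.tensorHom_def, whiskerLeft_comp, Category.assoc, ← reassoc_of% @br_tail,
    reassoc_of% @br_naturality_right, MonoidalCategory.tensorHom_def, whiskerLeft_comp]

/-- The truncation of `TV` in degrees less than `N`. -/
noncomputable def truncT (V : C) (N : ℕ) : T V ⟶ T V :=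
  Sigma.desc fun n => if n < N then inclT V n else 0

lemma inclT_truncT (V : C) (N n : ℕ) :
    inclT V n ≫ truncT V N = if n < N then inclT V n else 0 := by
  simp [inclT, truncT]

-- Truncation involves only finitely many degrees, so tensor products of truncations expand into
-- finite sums of bihomogeneous components.
open Classical in
lemma truncT_eq_sum (V : C) (N : ℕ) :
    truncT V N = ∑ i ∈ Finset.range N, Sigma.π (tpow V) i ≫ inclT V i := by
  refine T_hom_ext fun n => ?_
  rw [inclT_truncT, Preadditive.comp_sum]
  have h : ∀ i, i ≠ n → inclT V n ≫ Sigma.π (tpow V) i ≫ inclT V i = 0 := fun i hi => by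
    rw [inclT, ← Category.assoc, Sigma.ι_π_of_ne _ hi.symm, zero_comp]
  have h' : inclT V n ≫ Sigma.π (tpow V) n ≫ inclT V n = inclT V n := by
    rw [inclT, ← Category.assoc, Sigma.ι_π_eq_id, Category.id_comp]
  split_ifs with hn
  · rw [Finset.sum_eq_single_of_mem n (Finset.mem_range.2 hn) fun i _ hi => h i hi, h']
  · exact (Finset.sum_eq_zero fun i hi => h i (by have := Finset.mem_range.1 hi; omega)).symm

lemma truncT_truncT_succ (V : C) (N : ℕ) : truncT V N ≫ truncT V (N + 1) = truncT V N := by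
  refine T_hom_ext fun n => ?_
  rw [← Category.assoc, inclT_truncT]
  split_ifs with h
  · rw [inclT_truncT, if_pos (by omega)]
  · simp

lemma truncT_lcons (V : C) (N : ℕ) :
    V ◁ truncT V N ≫ lcons V ≫ truncT V (N + 1) = V ◁ truncT V N ≫ lcons V := by
  refine whiskerLeft_T_hom_ext fun n => ?_
  rw [← whiskerLeft_comp_assoc, ← whiskerLeft_comp_assoc, inclT_truncT]
  split_ifs with h
  · rw [incl_lcons, reassoc_of% @incl_lcons, inclT_truncT, if_pos (by omega)]
  · simp

/-- Each letter raises the degree of just one tensor factor, by one, so both factors of $\Delta$ on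
$V^{\otimes n}$ have degree at most $n$. -/
lemma inclT_coprodT_truncT (V : C) (n N : ℕ) (h : n < N) :
    inclT V n ≫ coprodT V ≫ (truncT V N ⊗ₘ truncT V N) = inclT V n ≫ coprodT V := by
  induction n generalizing N with
  | zero =>
    have : unitT V ≫ truncT V N = unitT V := by
      rw [unitT, Category.assoc, inclT_truncT, if_pos h]
    rw [inclT_zero_eq, Category.assoc, Category.assoc, reassoc_of% @unitT_coprodT, unitT_coprodT,
      tensorHom_comp_tensorHom, this]
  | succ n ih =>
    obtain ⟨N, rfl⟩ : ∃ M, N = M + 1 := ⟨N - 1, by omega⟩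
    have ih := ih N (by omega)
    have h1 : V ◁ (truncT V N ⊗ₘ truncT V N) ≫ op21 (lcons V) (T V) ≫
        (truncT V (N + 1) ⊗ₘ truncT V (N + 1)) =
        V ◁ (truncT V N ⊗ₘ truncT V N) ≫ op21 (lcons V) (T V) := by
      have e := tensorHom_op21 (truncT V N) (truncT V N) (lcons V)
      rw [reassoc_of% e, e, tensorHom_comp_tensorHom, Category.assoc, truncT_lcons,
        truncT_truncT_succ]
    have h2 : V ◁ (truncT V N ⊗ₘ truncT V N) ≫ br V (T V) (T V) ≫ T V ◁ lcons V ≫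
        (truncT V (N + 1) ⊗ₘ truncT V (N + 1)) =
        V ◁ (truncT V N ⊗ₘ truncT V N) ≫ br V (T V) (T V) ≫ T V ◁ lcons V := by
      have e := tensorHom_br (truncT V N) (truncT V N) (lcons V)
      rw [reassoc_of% e, e, tensorHom_comp_tensorHom, Category.assoc, truncT_lcons,
        truncT_truncT_succ]
    rw [inclT_succ_eq, Category.assoc, Category.assoc, Category.assoc, Category.assoc,
      reassoc_of% @lcons_coprodT, lcons_coprodT, ← whiskerLeft_comp_assoc,
      ← whiskerLeft_comp_assoc, ← ih,
      whiskerLeft_comp, whiskerLeft_comp]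
    simp only [Category.assoc, Preadditive.comp_add, Preadditive.add_comp, h1, h2]

variable [∀ X : C, PreservesFiniteLimits (tensorLeft X)]
  [∀ X : C, PreservesFiniteColimits (tensorLeft X)]

/-- Countable coproducts are not assumed exact, so the kernel of $F$ on all of $TV$ is not available
degreewise. Truncation reduces the claim to finitely many bidegrees $(i,j)$, in each of which
`comp_tensorHom_eq_zero` applies to $[i,\Psi]!\otimes[j,\Psi]!$. -/
lemma quotB_coprodB (V : C) : quotB V ≫ coprodB V = coprodT V ≫ (quotB V ⊗ₘ quotB V) := by
  classical
  refine comp_induced _ _ ⟨cokernel.desc _ _ ?_, cokernel.π_desc _ _ _⟩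
  refine Sigma.hom_ext _ _ fun n => ?_
  rw [comp_zero, Sigma.ι_map_assoc]
  change kernel.ι (braidedFactorial V n) ≫ inclT V n ≫ _ = 0
  obtain ⟨G, hG⟩ := exists_deconcatenation V n
  obtain ⟨f, hf⟩ : ∃ f, f = kernel.ι (braidedFactorial V n) ≫ inclT V n ≫ coprodT V := ⟨_, rfl⟩
  have h0 : f ≫ (factT V ⊗ₘ factT V) = 0 := by
    rw [hf, Category.assoc, Category.assoc, hG, kernel.condition_assoc, zero_comp]
  have h1 : f ≫ (truncT V (n + 1) ⊗ₘ truncT V (n + 1)) = f := by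
    rw [hf, Category.assoc, Category.assoc, inclT_coprodT_truncT V n _ (Nat.lt_succ_self n)]
  have hπ : ∀ i, factT V ≫ Sigma.π (tpow V) i = Sigma.π (tpow V) i ≫ braidedFactorial V i := by
    intro i
    refine T_hom_ext fun j => ?_
    rw [reassoc_of% @inclT_factT, inclT, ← Category.assoc (Sigma.ι _ _)]
    rcases eq_or_ne j i with rfl | hij
    · rw [Sigma.ι_π_eq_id]; simp
    · rw [Sigma.ι_π_of_ne _ hij]; simp
  have h2 : f ≫ (quotB V ⊗ₘ quotB V) = 0 := by
    rw [← h1, Category.assoc, tensorHom_comp_tensorHom, truncT_eq_sum, Preadditive.sum_comp,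
      sum_tensor, Preadditive.comp_sum]
    refine Finset.sum_eq_zero fun i _ => ?_
    rw [tensor_sum, Preadditive.comp_sum]
    refine Finset.sum_eq_zero fun j _ => ?_
    rw [Category.assoc, Category.assoc, ← tensorHom_comp_tensorHom, ← Category.assoc]
    refine comp_tensorHom_eq_zero _ _ _ _ _ ?_ (kernel_inclT_quotB V i) (kernel_inclT_quotB V j)
    rw [Category.assoc, tensorHom_comp_tensorHom, ← hπ, ← hπ, ← tensorHom_comp_tensorHom,
      reassoc_of% h0, zero_comp]
  rw [hf] at h2
  simpa using h2

end CoproductB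

/-! ## The algebra `B₊(V)` and its skew derivations -/

section AlgebraB

variable {C : Type u} [Category.{v} C] [Abelian C] [MonoidalCategory C] [BraidedCategory C]
  [HasCoproductsOfShape ℕ C] [∀ X : C, PreservesColimitsOfShape (Discrete ℕ) (tensorLeft X)]
  [MonoidalPreadditive C] [∀ X : C, PreservesFiniteLimits (tensorLeft X)]
  [∀ X : C, PreservesFiniteColimits (tensorLeft X)]

/-- The component `B ⟶ V ⊗ B` of the coproduct. -/
noncomputable def leftDB (V : C) : B V ⟶ V ⊗ B V := coprodB V ≫ varpi V ▷ B V

/-- The component `B ⟶ B ⊗ V` of the coproduct. -/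
noncomputable def rightDB (V : C) : B V ⟶ B V ⊗ V := coprodB V ≫ B V ◁ varpi V

lemma quotB_leftDB (V : C) : quotB V ≫ leftDB V = leftD V ≫ V ◁ quotB V := by
  rw [leftDB, reassoc_of% (quotB_coprodB V), MonoidalCategory.tensorHom_def', Category.assoc,
    ← comp_whiskerRight, quotB_varpi, whisker_exchange, leftD, Category.assoc]

lemma quotB_rightDB (V : C) : quotB V ≫ rightDB V = rightD V ≫ quotB V ▷ V := by
  rw [rightDB, reassoc_of% (quotB_coprodB V), MonoidalCategory.tensorHom_def, Category.assoc,
    ← whiskerLeft_comp, quotB_varpi, ← whisker_exchange, rightD, Category.assoc]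

lemma quotB_op12_leftDB (V M : C) :
    quotB V ▷ M ≫ op12 (leftDB V) M = op12 (leftD V) M ≫ V ◁ quotB V ▷ M := by
  rw [← op12_comp, quotB_leftDB, op12_comp_whiskerLeft]

lemma quotB_op12_rightDB (V M : C) :
    quotB V ▷ M ≫ op12 (rightDB V) M = op12 (rightD V) M ≫ quotB V ▷ (V ⊗ M) := by
  rw [← op12_comp, quotB_rightDB, op12_comp_whiskerRight]

lemma quotB_op21_mulB (V M : C) :
    T V ◁ quotB V ▷ M ≫ quotB V ▷ (B V ⊗ M) ≫ op21 (mulB V) M = op21 (mulT V) M ≫ quotB V ▷ M := by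
  rw [← op21_whiskerRight_comp, ← op21_whiskerLeft_comp, ← op21_comp, ← quotB_mulB,
    MonoidalCategory.tensorHom_def', Category.assoc]

/-- Right exactness keeps the quotient maps epi after tensoring, so identities on $B\otimes B\otimes
M$ may be verified on $TV\otimes TV\otimes M$. -/
lemma quotB_tensor_cancel {V M Y : C} {f g : B V ⊗ (B V ⊗ M) ⟶ Y}
    (h : T V ◁ quotB V ▷ M ≫ quotB V ▷ (B V ⊗ M) ≫ f =
      T V ◁ quotB V ▷ M ≫ quotB V ▷ (B V ⊗ M) ≫ g) : f = g := by
  rwa [cancel_epi, cancel_epi] at h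

lemma unitB_mulB (V : C) : unitB V ▷ B V ≫ mulB V = (λ_ (B V)).hom := by
  rw [← cancel_epi (𝟙_ C ◁ quotB V), unitB, comp_whiskerRight, Category.assoc,
    whisker_exchange_assoc, ← MonoidalCategory.tensorHom_def'_assoc, quotB_mulB,
    reassoc_of% @unitT_mulT,
    leftUnitor_naturality]

lemma mulB_unitB (V : C) : B V ◁ unitB V ≫ mulB V = (ρ_ (B V)).hom := by
  rw [← cancel_epi (quotB V ▷ 𝟙_ C), unitB, whiskerLeft_comp, Category.assoc,
    ← whisker_exchange_assoc, ← MonoidalCategory.tensorHom_def_assoc, quotB_mulB,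
    reassoc_of% @mulT_unitT,
    rightUnitor_naturality]

/-- `B` is associative. -/
lemma mulB_assoc (V : C) : mulB V ▷ B V ≫ mulB V = (α_ _ _ _).hom ≫ B V ◁ mulB V ≫ mulB V := by
  have e₁ : ((quotB V ⊗ₘ quotB V) ⊗ₘ quotB V) ≫ mulB V ▷ B V =
      mulT V ▷ T V ≫ (quotB V ⊗ₘ quotB V) := by
    rw [← tensorHom_id, tensorHom_comp_tensorHom, quotB_mulB, Category.comp_id, ← tensorHom_id,
      tensorHom_comp_tensorHom, Category.id_comp]
  have e₂ : (quotB V ⊗ₘ (quotB V ⊗ₘ quotB V)) ≫ B V ◁ mulB V =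
      T V ◁ mulT V ≫ (quotB V ⊗ₘ quotB V) := by
    rw [← id_tensorHom, tensorHom_comp_tensorHom, quotB_mulB, Category.comp_id, ← id_tensorHom,
      tensorHom_comp_tensorHom, Category.id_comp]
  rw [← cancel_epi ((quotB V ⊗ₘ quotB V) ⊗ₘ quotB V), associator_naturality_assoc,
    reassoc_of% e₁, reassoc_of% e₂, quotB_mulB, ← reassoc_of% (mulT_assoc V), op21,
    Category.assoc, Iso.hom_inv_id_assoc]

/-- `leftDB` is a braided derivation. -/
lemma mulB_leftDB (V M : C) :
    op21 (mulB V) M ≫ op12 (leftDB V) M =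
      op12 (leftDB V) (B V ⊗ M) ≫ V ◁ op21 (mulB V) M +
        B V ◁ op12 (leftDB V) M ≫ br (B V) V (B V ⊗ M) ≫ V ◁ op21 (mulB V) M := by
  refine quotB_tensor_cancel ?_
  simp only [Preadditive.comp_add]
  rw [reassoc_of% @quotB_op21_mulB, quotB_op12_leftDB, reassoc_of% (mulT_leftD V M),
    reassoc_of% @quotB_op12_leftDB, ← reassoc_of% @op12_tail, ← whisker_exchange_assoc,
    reassoc_of% @br_naturality_left,
    ← whiskerLeft_comp_assoc (T V), quotB_op12_leftDB, whiskerLeft_comp_assoc,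
    ← reassoc_of% @br_tail]
  simp only [← whiskerLeft_comp, quotB_op21_mulB, Preadditive.add_comp, Category.assoc]

/-- `rightDB` is a braided derivation. -/
lemma mulB_rightDB (V M : C) :
    op21 (mulB V) M ≫ op12 (rightDB V) M =
      B V ◁ op12 (rightDB V) M ≫ op21 (mulB V) (V ⊗ M) +
        op12 (rightDB V) (B V ⊗ M) ≫ B V ◁ br V (B V) M ≫ op21 (mulB V) (V ⊗ M) := by
  refine quotB_tensor_cancel ?_
  simp only [Preadditive.comp_add]
  rw [reassoc_of% @quotB_op21_mulB, quotB_op12_rightDB, reassoc_of% (mulT_rightD V M),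
    reassoc_of% @quotB_op12_rightDB, ← reassoc_of% @op12_tail, ← whisker_exchange_assoc,
    ← whiskerLeft_comp_assoc, quotB_op12_rightDB, whiskerLeft_comp_assoc, quotB_op21_mulB,
    ← whisker_exchange_assoc, ← whiskerLeft_comp_assoc (T V) (V ◁ quotB V ▷ M),
    br_naturality_right, whiskerLeft_comp_assoc, quotB_op21_mulB]
  simp only [Preadditive.add_comp, Category.assoc]

lemma leftDB_rightDB (V : C) :
    rightDB V ≫ op12 (leftDB V) V = leftDB V ≫ V ◁ rightDB V := by
  rw [← cancel_epi (quotB V), reassoc_of% @quotB_rightDB, quotB_op12_leftDB,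
    reassoc_of% (leftD_rightD V), reassoc_of% @quotB_leftDB, ← whiskerLeft_comp, ← whiskerLeft_comp,
    quotB_rightDB]

lemma leftDB_leftDB (V : C) {W : C} (Q : V ⊗ V ⟶ W) (hQ : (β_ V V).hom ≫ Q + Q = 0) :
    leftDB V ≫ V ◁ leftDB V ≫ op21 Q (B V) = 0 := by
  rw [← cancel_epi (quotB V), reassoc_of% @quotB_leftDB, ← whiskerLeft_comp_assoc, quotB_leftDB,
    whiskerLeft_comp_assoc, ← op21_tail, reassoc_of% (leftD_leftD V Q hQ), zero_comp, comp_zero]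

lemma rightDB_rightDB (V : C) {W : C} (Q : V ⊗ V ⟶ W) (hQ : (β_ V V).hom ≫ Q + Q = 0) :
    rightDB V ≫ op12 (rightDB V) V ≫ B V ◁ Q = 0 := by
  rw [← cancel_epi (quotB V), reassoc_of% @quotB_rightDB, reassoc_of% @quotB_op12_rightDB,
    ← whisker_exchange,
    reassoc_of% (rightD_rightD V Q hQ), zero_comp, comp_zero]

end AlgebraB

/-! ## The tensor powers and the braided exterior algebra -/

section Exterior

variable {C : Type u} [Category.{v} C] [Abelian C] [MonoidalCategory C] [BraidedCategory C]

lemma op21_tcons_tmul (V : C) (m n k l : ℕ) (h : m + n = k) (h' : m + 1 + n = l)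
    (hl : k + 1 = l) :
    op21 (tcons V m).hom (tpow V n) ≫ tmul V (m + 1) n l h' =
      V ◁ tmul V m n k h ≫ (tcons V k).hom ≫ eqToHom (by rw [hl]) := by
  subst hl
  rw [op21, Category.assoc, tcons_tmul V m n k h]
  simp

lemma tnil_tmul_eq (V : C) (n : ℕ) (h : 0 + n = n) :
    tmul V 0 n n h = (tnil V).inv ▷ tpow V n ≫ (λ_ (tpow V n)).hom := by
  rw [← tnil_tmul, ← comp_whiskerRight_assoc]; simp

instance (V M : C) (n : ℕ) : IsIso (op21 (tcons V n).hom M) := by unfold op21; infer_instance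

lemma tmul_tnil (V : C) (n : ℕ) :
    tpow V n ◁ (tnil V).hom ≫ tmul V n 0 n rfl = (ρ_ (tpow V n)).hom := by
  induction n with
  | zero =>
    rw [tnil_tmul_eq, whisker_exchange_assoc, ← cancel_epi ((tnil V).hom ▷ 𝟙_ C),
      ← comp_whiskerRight_assoc, leftUnitor_naturality, rightUnitor_naturality, unitors_equal]
    simp
  | succ n ih =>
    rw [← cancel_epi (op21 (tcons V n).hom (𝟙_ C)), reassoc_of% @op21_tail,
      op21_tcons_tmul V n 0 n (n + 1) rfl rfl rfl, ← whiskerLeft_comp_assoc, ih]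
    simp only [op21, eqToHom_refl, Category.comp_id, Category.assoc, rightUnitor_naturality]
    monoidal

lemma tmul_assoc (V : C) (m n l a b k : ℕ) (h₁ : m + n = a) (h₂ : n + l = b) (h₃ : a + l = k)
    (h₄ : m + b = k) :
    op21 (tmul V m n a h₁) (tpow V l) ≫ tmul V a l k h₃ =
      tpow V m ◁ tmul V n l b h₂ ≫ tmul V m b k h₄ := by
  induction m generalizing a k with
  | zero =>
    obtain rfl : n = a := by omega
    obtain rfl : b = k := by omega
    rw [tnil_tmul_eq, tnil_tmul_eq, op21_comp, whisker_exchange_assoc, leftUnitor_naturality,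
      op21]
    obtain rfl : h₂ = h₃ := rfl
    monoidal
  | succ m ih =>
    obtain ⟨a, rfl⟩ : ∃ c, a = c + 1 := ⟨m + n, by omega⟩
    obtain ⟨k, rfl⟩ : ∃ c, k = c + 1 := ⟨m + b, by omega⟩
    have ih := ih a k (by omega) (by omega) (by omega)
    have e := op21_assoc (by
      rw [op21_tcons_tmul V m n a (a + 1) (by omega) h₁ rfl, eqToHom_refl, Category.comp_id])
      (tpow V l)
    rw [← cancel_epi (op21 (tcons V m).hom (tpow V n ⊗ tpow V l)), reassoc_of% e,
      reassoc_of% @op21_tail,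
      op21_tcons_tmul V a l k (k + 1) (by omega) h₃ rfl,
      op21_tcons_tmul V m b k (k + 1) (by omega) h₄ rfl, ← whiskerLeft_comp_assoc, ih,
      whiskerLeft_comp_assoc]

lemma op21_tcons_braidFirst (V M : C) (m : ℕ) :
    V ◁ op21 (tcons V m).hom M ≫ op21 (tcons V (m + 1)).hom M ≫ braidFirst V m ▷ M =
      br V V (tpow V m ⊗ M) ≫ V ◁ op21 (tcons V m).hom M ≫ op21 (tcons V (m + 1)).hom M := by
  simp only [← op21_comp, braidFirst, Iso.hom_inv_id_assoc]
  have : V ◁ op21 (tcons V m).hom M = V ◁ (α_ _ _ _).inv ≫ V ◁ (tcons V m).hom ▷ M := by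
    simp [op21]
  rw [this, Category.assoc, ← op21_whiskerLeft_comp, ← whiskerLeft_comp_assoc V (tcons V m).hom,
    Iso.hom_inv_id, Category.assoc, ← op21_whiskerLeft_comp]
  simp only [op21, br]
  monoidal

lemma tcons_braidFirst (V : C) (m : ℕ) :
    V ◁ (tcons V m).hom ≫ (tcons V (m + 1)).hom ≫ braidFirst V m =
      br V V (tpow V m) ≫ V ◁ (tcons V m).hom ≫ (tcons V (m + 1)).hom := by
  simp [braidFirst, br, ← whiskerLeft_comp_assoc]

lemma tcons_tail (V : C) {m : ℕ} (f : tpow V m ⟶ tpow V m) :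
    (tcons V m).hom ≫ tail V f = V ◁ f ≫ (tcons V m).hom := by
  simp [tail]

/-- Concatenation on the right does not move the first $m$ letters. The bound on $i$ excludes the
default value $0$ of `braidAt` on the left side, where the right side may be a genuine braiding. -/
lemma braidAt_tmul (V : C) (m n k i : ℕ) (h : m + n = k) (hi : i + 2 ≤ m) :
    braidAt V m i ▷ tpow V n ≫ tmul V m n k h = tmul V m n k h ≫ braidAt V k i := by
  induction i generalizing m k with
  | zero =>
    obtain ⟨m, rfl⟩ : ∃ c, m = c + 2 := ⟨m - 2, by omega⟩
    obtain ⟨k, rfl⟩ : ∃ c, k = c + 2 := ⟨k - 2, by omega⟩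
    rw [← cancel_epi (op21 (tcons V (m + 1)).hom (tpow V n)),
      ← cancel_epi (V ◁ op21 (tcons V m).hom (tpow V n))]
    have e : V ◁ op21 (tcons V m).hom (tpow V n) ≫ op21 (tcons V (m + 1)).hom (tpow V n) ≫
        tmul V (m + 2) n (k + 2) h =
        V ◁ V ◁ tmul V m n k (by omega) ≫ V ◁ (tcons V k).hom ≫ (tcons V (k + 1)).hom := by
      rw [op21_tcons_tmul V (m + 1) n (k + 1) (k + 2) (by omega) h rfl, ← whiskerLeft_comp_assoc,
        op21_tcons_tmul V m n k (k + 1) (by omega) (by omega) rfl]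
      simp
    have e' := op21_tcons_braidFirst V (tpow V n) m
    change _ ≫ _ ≫ braidFirst V m ▷ _ ≫ _ = _ ≫ _ ≫ _ ≫ braidFirst V k
    rw [reassoc_of% e', e, reassoc_of% e, tcons_braidFirst, reassoc_of% @br_tail]
  | succ i ih =>
    obtain ⟨m, rfl⟩ : ∃ c, m = c + 2 := ⟨m - 2, by omega⟩
    obtain ⟨k, rfl⟩ : ∃ c, k = c + 2 := ⟨k - 2, by omega⟩
    have ih := ih (m + 1) (k + 1) (by omega) (by omega)
    rw [← cancel_epi (op21 (tcons V (m + 1)).hom (tpow V n))]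
    change _ ≫ (tail V (braidAt V (m + 1) i)) ▷ _ ≫ _ = _ ≫ _ ≫ tail V (braidAt V (k + 1) i)
    have e := op21_tcons_tmul V (m + 1) n (k + 1) (k + 2) (by omega) h rfl
    rw [eqToHom_refl, Category.comp_id] at e
    rw [← reassoc_of% @op21_comp, tcons_tail, reassoc_of% e, tcons_tail,
      reassoc_of% @op21_whiskerLeft_comp, e,
      ← whiskerLeft_comp_assoc, ih, whiskerLeft_comp_assoc]

/-- Each letter prepended shifts the position by one. With `braidAt_tmul` this shows that the
relations of $\Lambda$ are stable under multiplication on either side. -/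
lemma tmul_braidAt (V : C) (m n k i : ℕ) (h : m + n = k) (hi : i + 2 ≤ n) :
    tpow V m ◁ braidAt V n i ≫ tmul V m n k h = tmul V m n k h ≫ braidAt V k (m + i) := by
  induction m generalizing k with
  | zero =>
    obtain rfl : n = k := by omega
    rw [tnil_tmul_eq, whisker_exchange_assoc, leftUnitor_naturality, Category.assoc, Nat.zero_add]
  | succ m ih =>
    obtain ⟨k, rfl⟩ : ∃ c, k = c + 2 := ⟨k - 2, by omega⟩
    have ih := ih (k + 1) (by omega)
    rw [← cancel_epi (op21 (tcons V m).hom (tpow V n)), show m + 1 + i = (m + i) + 1 by omega]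
    change _ ≫ _ ≫ _ = _ ≫ _ ≫ tail V (braidAt V (k + 1) (m + i))
    have e := op21_tcons_tmul V m n (k + 1) (k + 2) (by omega) h rfl
    rw [eqToHom_refl, Category.comp_id] at e
    rw [reassoc_of% @op21_tail, e, reassoc_of% e, tcons_tail, ← whiskerLeft_comp_assoc, ih,
      whiskerLeft_comp_assoc]

instance (V : C) (n : ℕ) : Epi (quotExt V n) := by unfold quotExt; infer_instance

lemma braidAt_quotExt (V : C) (n i : ℕ) (hi : i + 2 ≤ n) :
    (𝟙 _ + braidAt V n i) ≫ quotExt V n = 0 := by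
  have h : Sigma.ι (fun _ : Fin (n - 1) => tpow V n) ⟨i, by omega⟩ ≫ relExt V n ≫
      quotExt V n = 0 := by
    rw [quotExt, cokernel.condition, comp_zero]
  simpa [relExt] using h

variable [MonoidalPreadditive C] [∀ X : C, PreservesFiniteColimits (tensorLeft X)]

lemma quotExt_wedge (V : C) (m n k : ℕ) (h : m + n = k) :
    (quotExt V m ⊗ₘ quotExt V n) ≫ wedge V m n k h = tmul V m n k h ≫ quotExt V k := by
  refine comp_induced _ _ (exists_tensorHom_cokernel_desc _ _ _ ?_ ?_)
  · refine whiskerRight_sigma_hom_ext fun i => ?_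
    rw [comp_zero, ← comp_whiskerRight_assoc, relExt, Sigma.ι_desc,
      MonoidalPreadditive.add_whiskerRight, Preadditive.add_comp, reassoc_of%
      (braidAt_tmul V m n k i h (by omega)), id_whiskerRight, Category.id_comp,
      ← Preadditive.comp_add]
    have := braidAt_quotExt V k i (by omega)
    rw [Preadditive.add_comp, Category.id_comp] at this
    rw [this, comp_zero]
  · refine whiskerLeft_sigma_hom_ext fun i => ?_
    rw [comp_zero, ← whiskerLeft_comp_assoc, relExt, Sigma.ι_desc,
      MonoidalPreadditive.whiskerLeft_add, Preadditive.add_comp, reassoc_of%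
      (tmul_braidAt V m n k i h (by omega)), whiskerLeft_id, Category.id_comp,
      ← Preadditive.comp_add]
    have := braidAt_quotExt V k (m + i) (by omega)
    rw [Preadditive.add_comp, Category.id_comp] at this
    rw [this, comp_zero]

lemma wedge_assoc_untailed (V : C) (m n l a b k : ℕ) (h₁ : m + n = a) (h₂ : n + l = b)
    (h₃ : a + l = k) (h₄ : m + b = k) :
    op21 (wedge V m n a h₁) (Lam V l) ≫ wedge V a l k h₃ =
      Lam V m ◁ wedge V n l b h₂ ≫ wedge V m b k h₄ := by
  rw [← cancel_epi (quotExt V m ⊗ₘ (quotExt V n ⊗ₘ quotExt V l))]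
  have e1 : (quotExt V m ⊗ₘ (quotExt V n ⊗ₘ quotExt V l)) ≫
      op21 (wedge V m n a h₁) (Lam V l) =
      op21 (tmul V m n a h₁) (tpow V l) ≫ (quotExt V a ⊗ₘ quotExt V l) := by
    rw [op21, associator_inv_naturality_assoc, ← tensorHom_id, tensorHom_comp_tensorHom,
      quotExt_wedge, Category.comp_id, op21, Category.assoc, ← tensorHom_id,
      tensorHom_comp_tensorHom, Category.id_comp]
  have e2 : (quotExt V m ⊗ₘ (quotExt V n ⊗ₘ quotExt V l)) ≫ Lam V m ◁ wedge V n l b h₂ =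
      tpow V m ◁ tmul V n l b h₂ ≫ (quotExt V m ⊗ₘ quotExt V b) := by
    rw [← id_tensorHom, tensorHom_comp_tensorHom, quotExt_wedge, Category.comp_id,
      ← id_tensorHom, tensorHom_comp_tensorHom, Category.id_comp]
  rw [reassoc_of% e1, reassoc_of% e2, quotExt_wedge, quotExt_wedge,
    reassoc_of% (tmul_assoc V m n l a b k h₁ h₂ h₃ h₄)]

lemma unitExt_wedge (V : C) (n : ℕ) (h : 0 + n = n) :
    unitExt V ▷ Lam V n ≫ wedge V 0 n n h = (λ_ (Lam V n)).hom := by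
  rw [← cancel_epi (𝟙_ C ◁ quotExt V n), unitExt, comp_whiskerRight, Category.assoc,
    whisker_exchange_assoc, ← MonoidalCategory.tensorHom_def'_assoc, quotExt_wedge,
    tnil_tmul_eq, leftUnitor_naturality]
  simp [← comp_whiskerRight_assoc]

lemma wedge_unitExt (V : C) (n : ℕ) (h : n + 0 = n) :
    Lam V n ◁ unitExt V ≫ wedge V n 0 n h = (ρ_ (Lam V n)).hom := by
  rw [← cancel_epi (quotExt V n ▷ 𝟙_ C), unitExt, whiskerLeft_comp, Category.assoc,
    ← whisker_exchange_assoc, ← MonoidalCategory.tensorHom_def_assoc, quotExt_wedge,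
    reassoc_of% (tmul_tnil V n), rightUnitor_naturality]

/-- Left multiplication of `Λ` by generators. -/
noncomputable def wedgeGenLeft (V : C) (q : ℕ) : V ⊗ Lam V q ⟶ Lam V (q + 1) :=
  genExt V ▷ Lam V q ≫ wedge V 1 q (q + 1) (Nat.add_comm 1 q)

/-- Right multiplication of `Λ` by generators. -/
noncomputable def wedgeGenRight (V : C) (p : ℕ) : Lam V p ⊗ V ⟶ Lam V (p + 1) :=
  Lam V p ◁ genExt V ≫ wedge V p 1 (p + 1) rfl

lemma tone_tmul (V : C) (n : ℕ) :
    (tone V).hom ▷ tpow V n ≫ tmul V 1 n (n + 1) (Nat.add_comm 1 n) = (tcons V n).hom := by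
  have e := tcons_tmul V 0 n n (Nat.zero_add n)
  simp only [tone, Iso.trans_hom, Iso.symm_hom, whiskerLeftIso_hom, comp_whiskerRight,
    Category.assoc]
  rw [e, tnil_tmul_eq, associator_naturality_middle_assoc, ← whiskerLeft_comp_assoc,
    ← comp_whiskerRight_assoc, Iso.hom_inv_id]
  monoidal

lemma quotExt_wedgeGenLeft (V : C) (n : ℕ) :
    V ◁ quotExt V n ≫ wedgeGenLeft V n = (tcons V n).hom ≫ quotExt V (n + 1) := by
  rw [wedgeGenLeft, genExt, comp_whiskerRight, Category.assoc, whisker_exchange_assoc,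
    ← MonoidalCategory.tensorHom_def'_assoc, quotExt_wedge, ← tone_tmul, Category.assoc]

/-- $\Lambda$ is generated in degree one; this drives the inductions for graded commutation. -/
instance (V : C) (n : ℕ) : Epi (wedgeGenLeft V n) := by
  have : Epi (V ◁ quotExt V n ≫ wedgeGenLeft V n) := by
    rw [quotExt_wedgeGenLeft]; infer_instance
  exact epi_of_epi (V ◁ quotExt V n) _

/-- The product `V ⊗ V ⟶ Λ²`. -/
noncomputable def wedgeGen (V : C) : V ⊗ V ⟶ Lam V 2 := V ◁ genExt V ≫ wedgeGenLeft V 1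

lemma wedgeGen_eq (V : C) : wedgeGen V = genExt V ▷ V ≫ wedgeGenRight V 1 := by
  rw [wedgeGen, wedgeGenLeft, wedgeGenRight, whisker_exchange_assoc]

/-- The defining relation of $\Lambda$ in degree two, transported along $V\otimes V\cong V^{\otimes
2}$. It supplies the map $Q$ for the squares of the skew derivations. -/
lemma braiding_wedgeGen (V : C) : (β_ V V).hom ≫ wedgeGen V + wedgeGen V = 0 := by
  have h : wedgeGen V = (V ◁ ((ρ_ V).inv ≫ V ◁ (tnil V).hom)) ≫
      V ◁ (tcons V 0).hom ≫ (tcons V 1).hom ≫ quotExt V 2 := by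
    rw [wedgeGen, genExt, whiskerLeft_comp, Category.assoc, quotExt_wedgeGenLeft]
    simp [tone]
  have h' : (β_ V V).hom ≫ V ◁ ((ρ_ V).inv ≫ V ◁ (tnil V).hom) =
      V ◁ ((ρ_ V).inv ≫ V ◁ (tnil V).hom) ≫ br V V (tpow V 0) := by
    have h₁ : (β_ V V).hom ≫ V ◁ (ρ_ V).inv = V ◁ (ρ_ V).inv ≫ br V V (𝟙_ C) := by
      rw [br]; monoidal
    rw [whiskerLeft_comp, reassoc_of% h₁, br_tail, Category.assoc]
  have h'' := braidAt_quotExt V 2 0 le_rfl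
  rw [Preadditive.add_comp, Category.id_comp, add_comm] at h''
  change braidFirst V 0 ≫ _ + _ = 0 at h''
  have e : V ◁ (tcons V 0).hom ≫ (tcons V 1).hom ≫ braidFirst V 0 = _ := tcons_braidFirst V 0
  rw [h, reassoc_of% h', ← reassoc_of% e, ← Preadditive.comp_add, ← Preadditive.comp_add,
    ← Preadditive.comp_add, h'', comp_zero, comp_zero, comp_zero]

lemma br_wedgeGen (V M : C) : br V V M ≫ op21 (wedgeGen V) M = -op21 (wedgeGen V) M := by
  rw [eq_neg_iff_add_eq_zero]
  have := congrArg (fun f => (α_ V V M).inv ≫ f ▷ M) (braiding_wedgeGen V)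
  simpa [br, op21] using this

lemma wedgeGenLeft_wedgeGenLeft (V : C) (n : ℕ) :
    V ◁ wedgeGenLeft V n ≫ wedgeGenLeft V (n + 1) =
      op21 (wedgeGen V) (Lam V n) ≫ wedge V 2 n (n + 2) (Nat.add_comm 2 n) := by
  have h := wedge_assoc_untailed V 1 1 n 2 (n + 1) (n + 2) rfl (Nat.add_comm 1 n)
    (Nat.add_comm 2 n) (by omega)
  rw [wedgeGen, wedgeGenLeft, wedgeGenLeft, wedgeGenLeft, op21_whiskerLeft_comp,
    op21_whiskerRight_comp, Category.assoc, Category.assoc, h, whiskerLeft_comp, Category.assoc,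
    whisker_exchange_assoc]

lemma br_wedgeGenLeft (V : C) (n : ℕ) :
    br V V (Lam V n) ≫ V ◁ wedgeGenLeft V n ≫ wedgeGenLeft V (n + 1) =
      -(V ◁ wedgeGenLeft V n ≫ wedgeGenLeft V (n + 1)) := by
  rw [wedgeGenLeft_wedgeGenLeft, reassoc_of% (br_wedgeGen V), Preadditive.neg_comp]

lemma wedgeGenLeft_wedgeGenRight (V : C) (p : ℕ) :
    V ◁ wedgeGenRight V p ≫ wedgeGenLeft V (p + 1) =
      op21 (wedgeGenLeft V p) V ≫ wedgeGenRight V (p + 1) := by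
  have h := wedge_assoc_untailed V 1 p 1 (p + 1) (p + 1) (p + 2) (Nat.add_comm 1 p) rfl rfl
    (by omega)
  rw [wedgeGenLeft, wedgeGenLeft, wedgeGenRight, wedgeGenRight, op21_whiskerRight_comp,
    Category.assoc, reassoc_of% @op21_tail, h, whiskerLeft_comp, Category.assoc,
    whisker_exchange_assoc,
    whisker_exchange_assoc]

lemma braiding_op21_right (X : C) {Y Z : C} (f : X ⊗ Y ⟶ Z) (W : C) :
    W ◁ f ≫ (β_ W Z).hom = br W X Y ≫ X ◁ (β_ W Y).hom ≫ op21 f W := by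
  rw [BraidedCategory.braiding_naturality_right, BraidedCategory.braiding_tensor_right_hom, br,
    op21]
  simp

lemma braiding_op21_left (X : C) {Y Z : C} (f : X ⊗ Y ⟶ Z) (W : C) :
    op21 f W ≫ (β_ Z W).hom = X ◁ (β_ Y W).hom ≫ br X W Y ≫ W ◁ f := by
  rw [op21, Category.assoc, BraidedCategory.braiding_naturality_left,
    BraidedCategory.braiding_tensor_left_hom, br]
  simp

lemma whiskerLeft_zsmul (X : C) {Y Z : C} (n : ℤ) (f : Y ⟶ Z) : X ◁ (n • f) = n • X ◁ f :=
  (tensorLeft X).map_zsmul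

lemma zsmul_whiskerRight (X : C) {Y Z : C} (n : ℤ) (f : Y ⟶ Z) : (n • f) ▷ X = n • f ▷ X :=
  (tensorRight X).map_zsmul

instance (V : C) : Epi (unitExt V) := by unfold unitExt; infer_instance

lemma unitExt_wedgeGenLeft (V : C) : V ◁ unitExt V ≫ wedgeGenLeft V 0 = (ρ_ V).hom ≫ genExt V := by
  rw [wedgeGenLeft, whisker_exchange_assoc, wedge_unitExt, rightUnitor_naturality]

lemma unitExt_wedgeGenRight (V : C) :
    unitExt V ▷ V ≫ wedgeGenRight V 0 = (λ_ V).hom ≫ genExt V := by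
  rw [wedgeGenRight, ← whisker_exchange_assoc, unitExt_wedge, leftUnitor_naturality]

/-- Generators graded-commute with `Λ` up to the braiding. -/
lemma wedgeGenLeft_eq (V : C) (p : ℕ) :
    wedgeGenLeft V p = (-1 : ℤ) ^ p • ((β_ V (Lam V p)).hom ≫ wedgeGenRight V p) := by
  induction p with
  | zero =>
    rw [← cancel_epi (V ◁ unitExt V), pow_zero, one_smul, unitExt_wedgeGenLeft,
      BraidedCategory.braiding_naturality_right_assoc, unitExt_wedgeGenRight,
      braiding_tensorUnit_right]
    simp
  | succ p ih =>
    have e : V ◁ wedgeGenLeft V p =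
        (-1 : ℤ) ^ p • V ◁ ((β_ V (Lam V p)).hom ≫ wedgeGenRight V p) := by
      conv_lhs => rw [ih, whiskerLeft_zsmul]
    -- It suffices to move $v$ past $w\wedge\omega$. Crossing $\omega$ is the induction hypothesis,
    -- after associativity detaches $w$; crossing $w$ contributes the extra $-1$ through
    -- `br_wedgeGenLeft`.
    rw [← cancel_epi (V ◁ wedgeGenLeft V p), Preadditive.comp_zsmul,
      reassoc_of% (braiding_op21_right V (wedgeGenLeft V p) V), ← wedgeGenLeft_wedgeGenRight,
      ← whiskerLeft_comp_assoc, pow_succ, mul_neg_one, neg_smul, ← Preadditive.comp_zsmul,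
      ← Preadditive.zsmul_comp, ← e, br_wedgeGenLeft, neg_neg]

/-- `Λ` graded-commutes with generators up to the braiding. -/
lemma wedgeGenRight_eq (V : C) (p : ℕ) :
    wedgeGenRight V p = (-1 : ℤ) ^ p • ((β_ (Lam V p) V).hom ≫ wedgeGenLeft V p) := by
  induction p with
  | zero =>
    rw [← cancel_epi (unitExt V ▷ V), pow_zero, one_smul, unitExt_wedgeGenRight,
      BraidedCategory.braiding_naturality_left_assoc, unitExt_wedgeGenLeft,
      braiding_tensorUnit_left]
    simp
  | succ p ih =>
    have e : V ◁ wedgeGenRight V p =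
        (-1 : ℤ) ^ p • V ◁ ((β_ (Lam V p) V).hom ≫ wedgeGenLeft V p) := by
      conv_lhs => rw [ih, whiskerLeft_zsmul]
    have : Epi (op21 (wedgeGenLeft V p) V) := by unfold op21; infer_instance
    -- The same induction for $(w\wedge\omega)\wedge v$. It is not the inverse of the previous
    -- formula: the braiding here is again $\Psi$, not $\Psi^{-1}$.
    rw [← cancel_epi (op21 (wedgeGenLeft V p) V), Preadditive.comp_zsmul,
      reassoc_of% (braiding_op21_left V (wedgeGenLeft V p) V), br_wedgeGenLeft,
      ← wedgeGenLeft_wedgeGenRight, e, whiskerLeft_comp, pow_succ, mul_neg_one, neg_smul,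
      Preadditive.zsmul_comp, Category.assoc, Preadditive.comp_neg, smul_neg, neg_neg]

end Exterior

/-! ## Braided tensor products of algebras -/

section BraidedTensorProduct

variable {C : Type u} [Category.{v} C] [MonoidalCategory C] [BraidedCategory C]

lemma tensorμ_tensorHom_eq {X X' X'' Y Y' Y'' : C} (f : X ⊗ X' ⟶ X'') (g : Y ⊗ Y' ⟶ Y'') :
    tensorμ X Y X' Y' ≫ (f ⊗ₘ g) =
      (α_ X Y (X' ⊗ Y')).hom ≫ X ◁ br Y X' Y' ≫ op21 f (Y ⊗ Y') ≫ X'' ◁ g := by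
  rw [tensorμ, MonoidalCategory.tensorHom_def, op21, br]
  monoidal

/-- Braided tensor products of associative products are associative. -/
lemma tensorμ_assoc {X₁ X₂ X₃ X₁₂ X₂₃ X Y₁ Y₂ Y₃ Y₁₂ Y₂₃ Y : C}
    {f₁₂ : X₁ ⊗ X₂ ⟶ X₁₂} {f₂₃ : X₂ ⊗ X₃ ⟶ X₂₃} {f : X₁₂ ⊗ X₃ ⟶ X} {f' : X₁ ⊗ X₂₃ ⟶ X}
    {g₁₂ : Y₁ ⊗ Y₂ ⟶ Y₁₂} {g₂₃ : Y₂ ⊗ Y₃ ⟶ Y₂₃} {g : Y₁₂ ⊗ Y₃ ⟶ Y} {g' : Y₁ ⊗ Y₂₃ ⟶ Y}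
    (hf : f₁₂ ▷ X₃ ≫ f = (α_ X₁ X₂ X₃).hom ≫ X₁ ◁ f₂₃ ≫ f')
    (hg : g₁₂ ▷ Y₃ ≫ g = (α_ Y₁ Y₂ Y₃).hom ≫ Y₁ ◁ g₂₃ ≫ g') :
    (tensorμ X₁ Y₁ X₂ Y₂ ≫ (f₁₂ ⊗ₘ g₁₂)) ▷ (X₃ ⊗ Y₃) ≫ tensorμ X₁₂ Y₁₂ X₃ Y₃ ≫ (f ⊗ₘ g) =
      (α_ (X₁ ⊗ Y₁) (X₂ ⊗ Y₂) (X₃ ⊗ Y₃)).hom ≫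
        (X₁ ⊗ Y₁) ◁ (tensorμ X₂ Y₂ X₃ Y₃ ≫ (f₂₃ ⊗ₘ g₂₃)) ≫
          tensorμ X₁ Y₁ X₂₃ Y₂₃ ≫ (f' ⊗ₘ g') := by
  rw [comp_whiskerRight, whiskerLeft_comp, Category.assoc, Category.assoc,
    tensorμ_natural_left_assoc, tensorμ_natural_right_assoc, tensorHom_comp_tensorHom,
    tensorHom_comp_tensorHom, hf, hg, ← tensorHom_comp_tensorHom, tensor_associativity_assoc]

lemma tensorμ_left_unit {X Y X₀ Y₀ : C} {a : 𝟙_ C ⟶ X₀} {b : 𝟙_ C ⟶ Y₀} {f : X₀ ⊗ X ⟶ X}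
    {g : Y₀ ⊗ Y ⟶ Y} (hf : a ▷ X ≫ f = (λ_ X).hom) (hg : b ▷ Y ≫ g = (λ_ Y).hom) :
    ((λ_ (𝟙_ C)).inv ≫ (a ⊗ₘ b)) ▷ (X ⊗ Y) ≫ tensorμ X₀ Y₀ X Y ≫ (f ⊗ₘ g) =
      (λ_ (X ⊗ Y)).hom := by
  rw [comp_whiskerRight, Category.assoc, tensorμ_natural_left_assoc, tensorHom_comp_tensorHom,
    hf, hg, tensor_left_unitality]

lemma tensorμ_right_unit {X Y X₀ Y₀ : C} {a : 𝟙_ C ⟶ X₀} {b : 𝟙_ C ⟶ Y₀} {f : X ⊗ X₀ ⟶ X}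
    {g : Y ⊗ Y₀ ⟶ Y} (hf : X ◁ a ≫ f = (ρ_ X).hom) (hg : Y ◁ b ≫ g = (ρ_ Y).hom) :
    (X ⊗ Y) ◁ ((λ_ (𝟙_ C)).inv ≫ (a ⊗ₘ b)) ≫ tensorμ X Y X₀ Y₀ ≫ (f ⊗ₘ g) =
      (ρ_ (X ⊗ Y)).hom := by
  rw [whiskerLeft_comp, Category.assoc, tensorμ_natural_right_assoc, tensorHom_comp_tensorHom,
    hf, hg, tensor_right_unitality]

end BraidedTensorProduct

/-! ## The bigraded algebra `Ω` -/

section Omega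

variable {C : Type u} [Category.{v} C] [Abelian C] [MonoidalCategory C] [BraidedCategory C]
  [HasCoproductsOfShape ℕ C] [∀ X : C, PreservesColimitsOfShape (Discrete ℕ) (tensorLeft X)]
  [MonoidalPreadditive C] [∀ X : C, PreservesFiniteLimits (tensorLeft X)]
  [∀ X : C, PreservesFiniteColimits (tensorLeft X)]

lemma wellDefined (V : C) : WellDefined V :=
  ⟨quotB_mulB V, quotB_coprodB V, quotB_varpi V, quotExt_wedge V⟩

/-- The product of the braided tensor product algebra `B ⊗ Λ`. -/
noncomputable def mulBExt (V : C) (q q' s : ℕ) (hs : q + q' = s) :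
    (B V ⊗ Lam V q) ⊗ (B V ⊗ Lam V q') ⟶ B V ⊗ Lam V s :=
  tensorμ (B V) (Lam V q) (B V) (Lam V q') ≫ (mulB V ⊗ₘ wedge V q q' s hs)

/-- The product of `Ω` without its sign. -/
noncomputable def mulUnsigned (V : C) (p q p' q' r s : ℕ) (hr : p + p' = r) (hs : q + q' = s) :
    Omega V p q ⊗ Omega V p' q' ⟶ Omega V r s :=
  tensorμ (Lam V p) (B V ⊗ Lam V q) (Lam V p') (B V ⊗ Lam V q') ≫
    (wedge V p p' r hr ⊗ₘ mulBExt V q q' s hs)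

lemma mulOmega_eq (V : C) (p q p' q' r s : ℕ) (hr : p + p' = r) (hs : q + q' = s) :
    mulOmega V p q p' q' r s hr hs =
      ((-1 : ℤ) ^ (q * p')) • mulUnsigned V p q p' q' r s hr hs := rfl

lemma wedge_assoc' (V : C) (m n l a b k : ℕ) (h₁ : m + n = a) (h₂ : n + l = b)
    (h₃ : a + l = k) (h₄ : m + b = k) :
    wedge V m n a h₁ ▷ Lam V l ≫ wedge V a l k h₃ =
      (α_ _ _ _).hom ≫ Lam V m ◁ wedge V n l b h₂ ≫ wedge V m b k h₄ := by
  rw [← wedge_assoc_untailed V m n l a b k h₁ h₂ h₃ h₄, op21]; simp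

lemma mulUnsigned_assoc (V : C) (p₁ q₁ p₂ q₂ p₃ q₃ p₁₂ q₁₂ p₂₃ q₂₃ p q : ℕ)
    (h₁ : p₁ + p₂ = p₁₂) (k₁ : q₁ + q₂ = q₁₂) (h₂ : p₂ + p₃ = p₂₃) (k₂ : q₂ + q₃ = q₂₃)
    (h₃ : p₁₂ + p₃ = p) (k₃ : q₁₂ + q₃ = q) (h₄ : p₁ + p₂₃ = p) (k₄ : q₁ + q₂₃ = q) :
    mulUnsigned V p₁ q₁ p₂ q₂ p₁₂ q₁₂ h₁ k₁ ▷ Omega V p₃ q₃ ≫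
        mulUnsigned V p₁₂ q₁₂ p₃ q₃ p q h₃ k₃ =
      (α_ (Omega V p₁ q₁) (Omega V p₂ q₂) (Omega V p₃ q₃)).hom ≫
        Omega V p₁ q₁ ◁ mulUnsigned V p₂ q₂ p₃ q₃ p₂₃ q₂₃ h₂ k₂ ≫
          mulUnsigned V p₁ q₁ p₂₃ q₂₃ p q h₄ k₄ :=
  tensorμ_assoc (wedge_assoc' V _ _ _ _ _ _ _ _ _ _)
    (tensorμ_assoc (mulB_assoc V) (wedge_assoc' V _ _ _ _ _ _ _ _ _ _))

lemma unitOmega_mulOmega (V : C) (p q : ℕ) :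
    (λ_ (Omega V p q)).inv ≫ unitOmega V ▷ Omega V p q ≫
      mulOmega V 0 0 p q p q (Nat.zero_add p) (Nat.zero_add q) = 𝟙 _ := by
  rw [mulOmega_eq, Nat.zero_mul, pow_zero, one_smul, Iso.inv_comp_eq, Category.comp_id]
  exact tensorμ_left_unit (unitExt_wedge V p _)
    (tensorμ_left_unit (unitB_mulB V) (unitExt_wedge V q _))

lemma mulOmega_unitOmega (V : C) (p q : ℕ) :
    (ρ_ (Omega V p q)).inv ≫ Omega V p q ◁ unitOmega V ≫
      mulOmega V p q 0 0 p q (Nat.add_zero p) (Nat.add_zero q) = 𝟙 _ := by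
  rw [mulOmega_eq, Nat.mul_zero, pow_zero, one_smul, Iso.inv_comp_eq, Category.comp_id]
  exact tensorμ_right_unit (wedge_unitExt V p _)
    (tensorμ_right_unit (mulB_unitB V) (wedge_unitExt V q _))

lemma neg_one_pow_congr {m n : ℕ} (h : m % 2 = n % 2) : (-1 : ℤ) ^ m = (-1 : ℤ) ^ n := by
  rw [neg_one_pow_eq_pow_mod_two, h, ← neg_one_pow_eq_pow_mod_two]

lemma mulOmega_assoc (V : C) (p₁ q₁ p₂ q₂ p₃ q₃ p₁₂ q₁₂ p₂₃ q₂₃ p q : ℕ)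
    (h₁ : p₁ + p₂ = p₁₂) (k₁ : q₁ + q₂ = q₁₂) (h₂ : p₂ + p₃ = p₂₃) (k₂ : q₂ + q₃ = q₂₃)
    (h₃ : p₁₂ + p₃ = p) (k₃ : q₁₂ + q₃ = q) (h₄ : p₁ + p₂₃ = p) (k₄ : q₁ + q₂₃ = q) :
    mulOmega V p₁ q₁ p₂ q₂ p₁₂ q₁₂ h₁ k₁ ▷ Omega V p₃ q₃ ≫
        mulOmega V p₁₂ q₁₂ p₃ q₃ p q h₃ k₃ =
      (α_ (Omega V p₁ q₁) (Omega V p₂ q₂) (Omega V p₃ q₃)).hom ≫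
        Omega V p₁ q₁ ◁ mulOmega V p₂ q₂ p₃ q₃ p₂₃ q₂₃ h₂ k₂ ≫
          mulOmega V p₁ q₁ p₂₃ q₂₃ p q h₄ k₄ := by
  simp only [mulOmega_eq, zsmul_whiskerRight, whiskerLeft_zsmul, Preadditive.zsmul_comp,
    Preadditive.comp_zsmul, smul_smul,
    mulUnsigned_assoc V p₁ q₁ p₂ q₂ p₃ q₃ p₁₂ q₁₂ p₂₃ q₂₃ p q h₁ k₁ h₂ k₂ h₃ k₃ h₄ k₄]
  -- Both exponents equal $q_1p_2+q_1p_3+q_2p_3$, because $(q,p')\mapsto qp'$ is bilinear.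
  congr 1
  subst k₁ h₂
  ring

end Omega

/-! ## The differentials of `Ω` -/

section Differentials

variable {C : Type u} [Category.{v} C] [Abelian C] [MonoidalCategory C] [BraidedCategory C]
  [MonoidalPreadditive C] [∀ X : C, PreservesFiniteColimits (tensorLeft X)]

lemma wedge_wedgeGenRight (V M : C) (p p' r : ℕ) (hr : p + p' = r) :
    op21 (wedge V p p' r hr) (V ⊗ M) ≫ op21 (wedgeGenRight V r) M =
      Lam V p ◁ op21 (wedgeGenRight V p') M ≫ op21 (wedge V p (p' + 1) (r + 1) (by omega)) M := by
  refine op21_assoc ?_ M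
  rw [wedgeGenRight, reassoc_of% @op21_tail,
    wedge_assoc_untailed V p p' 1 r (p' + 1) (r + 1) hr rfl rfl
    (by omega), wedgeGenRight, whiskerLeft_comp, Category.assoc]

lemma wedgeGenRight_wedge_untailed (V : C) (p p' r : ℕ) (hr : p + p' = r) :
    op21 (wedgeGenRight V p) (Lam V p') ≫ wedge V (p + 1) p' (r + 1) (by omega) =
      Lam V p ◁ wedgeGenLeft V p' ≫ wedge V p (p' + 1) (r + 1) (by omega) := by
  rw [wedgeGenRight, op21_whiskerLeft_comp, Category.assoc, wedge_assoc_untailed V p 1 p' (p + 1)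
    (p' + 1) (r + 1) rfl (Nat.add_comm 1 p') (by omega) (by omega), wedgeGenLeft, whiskerLeft_comp,
    Category.assoc]

lemma wedgeGenRight_wedge (V M : C) (p p' r : ℕ) (hr : p + p' = r) :
    op21 (wedgeGenRight V p) (Lam V p' ⊗ M) ≫ op21 (wedge V (p + 1) p' (r + 1) (by omega)) M =
      Lam V p ◁ op21 (wedgeGenLeft V p') M ≫ op21 (wedge V p (p' + 1) (r + 1) (by omega)) M :=
  op21_assoc (wedgeGenRight_wedge_untailed V p p' r hr) M

lemma wedgeGenLeft_wedge (V : C) (q q' s : ℕ) (hs : q + q' = s) :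
    V ◁ wedge V q q' s hs ≫ wedgeGenLeft V s =
      op21 (wedgeGenLeft V q) (Lam V q') ≫ wedge V (q + 1) q' (s + 1) (by omega) := by
  rw [wedgeGenLeft, whisker_exchange_assoc, wedgeGenLeft, op21_whiskerRight_comp, Category.assoc,
    wedge_assoc_untailed V 1 q q' (q + 1) s (s + 1) (by omega) hs (by omega) (by omega)]

lemma op21_zsmul {X Y Z : C} (n : ℤ) (f : X ⊗ Y ⟶ Z) (M : C) :
    op21 (n • f) M = n • op21 f M := by
  rw [op21, zsmul_whiskerRight, Preadditive.comp_zsmul, op21]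

lemma op21_wedgeGenLeft_eq (V M : C) (p : ℕ) :
    op21 (wedgeGenLeft V p) M = (-1 : ℤ) ^ p • (br V (Lam V p) M ≫ op21 (wedgeGenRight V p) M) := by
  rw [wedgeGenLeft_eq, op21_zsmul, op21_comp, br, op21, op21]
  simp

lemma op21_wedgeGenRight_eq (V M : C) (p : ℕ) :
    op21 (wedgeGenRight V p) M = (-1 : ℤ) ^ p • (br (Lam V p) V M ≫ op21 (wedgeGenLeft V p) M) := by
  rw [wedgeGenRight_eq, op21_zsmul, op21_comp, br, op21, op21]
  simp

/-- The product of a braided tensor product `Λ ⊗ Y` on right-nested tensor products. -/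
noncomputable def nestedMul (V : C) (p p' r : ℕ) (hr : p + p' = r) {Y Y' Y'' : C}
    (μ : Y ⊗ Y' ⟶ Y'') : Lam V p ⊗ (Y ⊗ (Lam V p' ⊗ Y')) ⟶ Lam V r ⊗ Y'' :=
  Lam V p ◁ br Y (Lam V p') Y' ≫ op21 (wedge V p p' r hr) (Y ⊗ Y') ≫ Lam V r ◁ μ

/-- The map `Λᵖ ⊗ Y ⟶ Λ^{p+1} ⊗ Y'` induced by `d : Y ⟶ V ⊗ Y'`. -/
noncomputable def extDel (V : C) (p : ℕ) {Y Y' : C} (d : Y ⟶ V ⊗ Y') :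
    Lam V p ⊗ Y ⟶ Lam V (p + 1) ⊗ Y' :=
  Lam V p ◁ d ≫ op21 (wedgeGenRight V p) Y'

/-- If `d` is a braided derivation, then `extDel d` is a graded derivation. -/
lemma nestedMul_extDel (V : C) (p p' r : ℕ) (hr : p + p' = r) {Y Y' Y'' : C}
    (μ : Y ⊗ Y' ⟶ Y'') (d : Y ⟶ V ⊗ Y) (d' : Y' ⟶ V ⊗ Y') (d'' : Y'' ⟶ V ⊗ Y'')
    (h : μ ≫ d'' = op12 d Y' ≫ V ◁ μ + Y ◁ d' ≫ br Y V Y' ≫ V ◁ μ) :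
    nestedMul V p p' r hr μ ≫ extDel V r d'' =
      (-1 : ℤ) ^ p' • ((Lam V p ◁ op12 d (Lam V p' ⊗ Y') ≫
        op21 (wedgeGenRight V p) (Y ⊗ (Lam V p' ⊗ Y'))) ≫
          nestedMul V (p + 1) p' (r + 1) (by omega) μ) +
      Lam V p ◁ Y ◁ extDel V p' d' ≫ nestedMul V p (p' + 1) (r + 1) (by omega) μ := by
  simp only [nestedMul, extDel, Category.assoc]
  rw [← whiskerLeft_comp_assoc (Lam V r), h, MonoidalPreadditive.whiskerLeft_add,
    Preadditive.add_comp, Preadditive.comp_add, Preadditive.comp_add]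
  congr 1
  -- The letter $v$ extracted from $y$ is produced as $\omega\wedge\omega'\wedge v$ here, but as
  -- $\omega\wedge v\wedge\omega'$ on the other side. Graded commutation of $v$ with $\omega'$ gives
  -- $(-1)^{p'}$, which cancels the stated sign, and the braiding that carries all of $Dy$ past
  -- $\omega'$.
  · simp only [whiskerLeft_comp, Category.assoc]
    rw [← op21_tail, reassoc_of% (op21_tail (wedge V p p' r hr)),
      reassoc_of% (wedge_wedgeGenRight V (Y ⊗ Y') p p' r hr),
      reassoc_of% (op21_tail (wedgeGenRight V p)),
      reassoc_of% (wedgeGenRight_wedge V (Y ⊗ Y') p p' r hr), op21_wedgeGenLeft_eq,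
      whiskerLeft_zsmul]
    simp only [Preadditive.zsmul_comp, Preadditive.comp_zsmul, smul_smul]
    rw [← mul_pow, neg_one_mul, neg_neg, one_pow, one_smul]
    simp only [← whiskerLeft_comp_assoc, reassoc_of% @op12_br_left]
  · simp only [whiskerLeft_comp, Category.assoc]
    rw [← op21_tail, reassoc_of% (op21_tail (wedge V p p' r hr)),
      reassoc_of% (op21_tail (wedge V p p' r hr)),
      reassoc_of% (wedge_wedgeGenRight V (Y ⊗ Y') p p' r hr),
      ← whiskerLeft_comp_assoc _ (br Y (Lam V p') Y'), br_tail,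
      ← whiskerLeft_comp_assoc _ (Y ◁ op21 _ _), op21_br_right]
    simp only [whiskerLeft_comp, Category.assoc]

/-- A map acting on the second factor alone meets the left-hand $\Lambda$ only through naturality of
the braiding, so a twisted Leibniz rule on $Y$ passes to $\Lambda\otimes Y$ with the same
coefficient. -/
lemma nestedMul_whiskerLeft (V : C) (p p' r : ℕ) (hr : p + p' = r) {Y Y' Y'' Z Z' Z'' : C}
    (μ : Y ⊗ Y' ⟶ Y'') (μ₁ : Z ⊗ Y' ⟶ Z'') (μ₂ : Y ⊗ Z' ⟶ Z'') (e : Y ⟶ Z) (e' : Y' ⟶ Z')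
    (e'' : Y'' ⟶ Z'') (c : ℤ) (h : μ ≫ e'' = e ▷ Y' ≫ μ₁ + c • (Y ◁ e' ≫ μ₂)) :
    nestedMul V p p' r hr μ ≫ Lam V r ◁ e'' =
      Lam V p ◁ e ▷ (Lam V p' ⊗ Y') ≫ nestedMul V p p' r hr μ₁ +
        c • (Lam V p ◁ Y ◁ Lam V p' ◁ e' ≫ nestedMul V p p' r hr μ₂) := by
  simp only [nestedMul, Category.assoc]
  rw [← whiskerLeft_comp, h, MonoidalPreadditive.whiskerLeft_add, Preadditive.comp_add,
    Preadditive.comp_add, whiskerLeft_zsmul, Preadditive.comp_zsmul, Preadditive.comp_zsmul]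
  congr 1
  · rw [whiskerLeft_comp, reassoc_of% @op21_tail, ← whiskerLeft_comp_assoc,
      ← whiskerLeft_comp_assoc,
      br_naturality_left]
  · rw [whiskerLeft_comp, reassoc_of% @op21_tail, ← whiskerLeft_comp_assoc,
      ← whiskerLeft_comp_assoc,
      br_tail]

variable [HasCoproductsOfShape ℕ C] [∀ X : C, PreservesColimitsOfShape (Discrete ℕ) (tensorLeft X)]
  [∀ X : C, PreservesFiniteLimits (tensorLeft X)]

lemma mulUnsigned_eq (V : C) (p q p' q' r s : ℕ) (hr : p + p' = r) (hs : q + q' = s) :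
    mulUnsigned V p q p' q' r s hr hs =
      (α_ _ _ _).hom ≫ nestedMul V p p' r hr (mulBExt V q q' s hs) :=
  tensorμ_tensorHom_eq _ _

lemma mulBExt_eq (V : C) (q q' s : ℕ) (hs : q + q' = s) :
    mulBExt V q q' s hs = (α_ _ _ _).hom ≫ B V ◁ br (Lam V q) (B V) (Lam V q') ≫
      op21 (mulB V) (Lam V q ⊗ Lam V q') ≫ B V ◁ wedge V q q' s hs :=
  tensorμ_tensorHom_eq _ _

lemma delRight_eq (V : C) (p : ℕ) : delRight V p = extDel V p (leftDB V) := by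
  rw [delRight, extDel, leftDB, wedgeGenRight, op21_whiskerLeft_comp, op21]
  simp

lemma delLeft_eq (V : C) (q : ℕ) :
    delLeft V q = op12 (rightDB V) (Lam V q) ≫ B V ◁ wedgeGenLeft V q := by
  rw [delLeft, rightDB, op12_comp_whiskerLeft, wedgeGenLeft, op12]
  simp

lemma del_eq (V : C) (p q : ℕ) :
    del V p q = (-1 : ℤ) ^ p • extDel V p (op12 (leftDB V) (Lam V q)) := by
  rw [del, delRight_eq, extDel, extDel, op12, op21, op21]
  congr 1
  monoidal

/-- $D$ acts on $B$ and ignores $\Lambda$, so it stays a braided derivation of $B\otimes\Lambda$: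
its output letter crosses $\eta$ together with the rest of $b'$. This is the hypothesis needed by
`nestedMul_extDel`. -/
lemma mulBExt_leftDB (V : C) (q q' s : ℕ) (hs : q + q' = s) :
    mulBExt V q q' s hs ≫ op12 (leftDB V) (Lam V s) =
      op12 (op12 (leftDB V) (Lam V q)) (B V ⊗ Lam V q') ≫ V ◁ mulBExt V q q' s hs +
        (B V ⊗ Lam V q) ◁ op12 (leftDB V) (Lam V q') ≫ br (B V ⊗ Lam V q) V (B V ⊗ Lam V q') ≫
          V ◁ mulBExt V q q' s hs := by
  have h₁ : (α_ _ _ _).inv ≫ op12 (op12 (leftDB V) (Lam V q)) (B V ⊗ Lam V q') ≫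
      V ◁ (α_ _ _ _).hom = op12 (leftDB V) (Lam V q ⊗ (B V ⊗ Lam V q')) := by
    simp only [op12]; monoidal
  have h₂ : (α_ _ _ _).inv ≫ (B V ⊗ Lam V q) ◁ op12 (leftDB V) (Lam V q') ≫
      br (B V ⊗ Lam V q) V (B V ⊗ Lam V q') ≫ V ◁ (α_ _ _ _).hom =
      B V ◁ (Lam V q ◁ op12 (leftDB V) (Lam V q') ≫ br (Lam V q) V (B V ⊗ Lam V q')) ≫
        br (B V) V (Lam V q ⊗ (B V ⊗ Lam V q')) := by
    have := br_tensor_left (B V) (Lam V q) V (B V ⊗ Lam V q')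
    rw [← associator_inv_naturality_right_assoc, reassoc_of% this, ← whiskerLeft_comp]
    simp
  rw [← cancel_epi (α_ (B V) (Lam V q) (B V ⊗ Lam V q')).inv, mulBExt_eq]
  simp only [Preadditive.comp_add, whiskerLeft_comp, Category.assoc, Iso.inv_hom_id_assoc]
  rw [reassoc_of% h₁, reassoc_of% h₂, ← op12_tail, reassoc_of% (mulB_leftDB V _),
    Preadditive.add_comp, Preadditive.comp_add]
  congr 1
  · simp only [Category.assoc, reassoc_of% @op12_tail]
  · simp only [Category.assoc]
    rw [reassoc_of% @br_tail]
    simp only [← whiskerLeft_comp_assoc, Category.assoc, op12_br_right]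

lemma mulBExt_delLeft (V : C) (q q' s : ℕ) (hs : q + q' = s) :
    mulBExt V q q' s hs ≫ delLeft V s =
      delLeft V q ▷ (B V ⊗ Lam V q') ≫ mulBExt V (q + 1) q' (s + 1) (by omega) +
        (-1 : ℤ) ^ q • ((B V ⊗ Lam V q) ◁ delLeft V q' ≫
          mulBExt V q (q' + 1) (s + 1) (by omega)) := by
  have h₁ : (α_ _ _ _).inv ≫ delLeft V q ▷ (B V ⊗ Lam V q') ≫ (α_ _ _ _).hom =
      op12 (rightDB V) (Lam V q ⊗ (B V ⊗ Lam V q')) ≫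
        B V ◁ op21 (wedgeGenLeft V q) (B V ⊗ Lam V q') := by
    simp only [delLeft_eq, op12, op21]; monoidal
  rw [← cancel_epi (α_ (B V) (Lam V q) (B V ⊗ Lam V q')).inv]
  simp only [mulBExt_eq, Preadditive.comp_add, Preadditive.comp_zsmul, Iso.inv_hom_id_assoc,
    Category.assoc]
  rw [reassoc_of% h₁, ← associator_inv_naturality_right_assoc, Iso.inv_hom_id_assoc]
  simp only [delLeft_eq]
  rw [← reassoc_of% @op12_tail, ← whiskerLeft_comp (B V) (V ◁ _), wedgeGenLeft_wedge,
    reassoc_of% (mulB_rightDB V _),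
    Preadditive.add_comp, Preadditive.comp_add, add_comm (B V ◁ br _ _ _ ≫ _)]
  congr 1
  · rw [← whiskerLeft_comp_assoc (B V) (op21 _ _), op21_br_left]
    simp only [Category.assoc, whiskerLeft_comp, ← reassoc_of% @op21_tail, reassoc_of% @op12_tail]
  -- When $D'$ hits $b'$, its letter $v$ is braided past $\eta$ on one side and appears as
  -- $\eta\wedge v\wedge\eta'$ on the other. Graded commutation on the right, `wedgeGenRight_eq`,
  -- reconciles them and produces the sign $(-1)^q$.
  · have h₂ : Lam V q ◁ wedgeGenLeft V q' ≫ wedge V q (q' + 1) (s + 1) (by omega) =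
        (-1 : ℤ) ^ q • (br (Lam V q) V (Lam V q') ≫ op21 (wedgeGenLeft V q) (Lam V q') ≫
          wedge V (q + 1) q' (s + 1) (by omega)) := by
      rw [← wedgeGenRight_wedge_untailed V q q' s hs, op21_wedgeGenRight_eq,
        Preadditive.zsmul_comp, Category.assoc]
    rw [whiskerLeft_comp, whiskerLeft_comp (Lam V q), whiskerLeft_comp (B V) (Lam V q ◁ _),
      Category.assoc, Category.assoc,
      ← whiskerLeft_comp_assoc _ (Lam V q ◁ B V ◁ _), ← br_tail, whiskerLeft_comp_assoc,
      ← reassoc_of% @op21_tail, ← whiskerLeft_comp (B V) (Lam V q ◁ _), h₂, whiskerLeft_zsmul,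
      whiskerLeft_comp (B V) (br _ _ _), Preadditive.comp_zsmul, Preadditive.comp_zsmul,
      Preadditive.comp_zsmul, smul_smul, ← mul_pow, neg_one_mul, neg_neg, one_pow, one_smul]
    have h₃ := congrArg (fun f => B V ◁ f) (op12_br_right (Lam V q) (rightDB V) (Lam V q'))
    simp only [whiskerLeft_comp] at h₃
    simp only [whiskerLeft_comp, reassoc_of% @op21_tail]
    rw [reassoc_of% h₃]

end Differentials

/-! ### The double complex identities -/

section DoubleComplex

variable {C : Type u} [Category.{v} C] [Abelian C] [MonoidalCategory C] [BraidedCategory C]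
  [HasCoproductsOfShape ℕ C] [∀ X : C, PreservesColimitsOfShape (Discrete ℕ) (tensorLeft X)]
  [MonoidalPreadditive C] [∀ X : C, PreservesFiniteLimits (tensorLeft X)]
  [∀ X : C, PreservesFiniteColimits (tensorLeft X)]

lemma mulUnsigned_extDel (V : C) (p q p' q' r s : ℕ) (hr : p + p' = r) (hs : q + q' = s) :
    mulUnsigned V p q p' q' r s hr hs ≫ extDel V r (op12 (leftDB V) (Lam V s)) =
      (-1 : ℤ) ^ p' • (extDel V p (op12 (leftDB V) (Lam V q)) ▷ Omega V p' q' ≫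
        mulUnsigned V (p + 1) q p' q' (r + 1) s (by omega) hs) +
      Omega V p q ◁ extDel V p' (op12 (leftDB V) (Lam V q')) ≫
        mulUnsigned V p q (p' + 1) q' (r + 1) s (by omega) hs := by
  have h : extDel V p (op12 (leftDB V) (Lam V q)) ▷ Omega V p' q' ≫ (α_ _ _ _).hom =
      (α_ _ _ _).hom ≫ Lam V p ◁ op12 (op12 (leftDB V) (Lam V q)) (Omega V p' q') ≫
        op21 (wedgeGenRight V p) ((B V ⊗ Lam V q) ⊗ Omega V p' q') := by
    rw [extDel, op12.eq_1 (op12 _ _), op21, op21]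
    monoidal
  rw [mulUnsigned_eq, Category.assoc, nestedMul_extDel V p p' r hr _ _ _ _
    (mulBExt_leftDB V q q' s hs), mulUnsigned_eq, mulUnsigned_eq, reassoc_of% h,
    associator_naturality_right_assoc, Preadditive.comp_add, Preadditive.comp_zsmul,
    Category.assoc]

lemma mulUnsigned_delLeft (V : C) (p q p' q' r s : ℕ) (hr : p + p' = r) (hs : q + q' = s) :
    mulUnsigned V p q p' q' r s hr hs ≫ Lam V r ◁ delLeft V s =
      (Lam V p ◁ delLeft V q) ▷ Omega V p' q' ≫
        mulUnsigned V p (q + 1) p' q' r (s + 1) hr (by omega) +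
      (-1 : ℤ) ^ q • (Omega V p q ◁ Lam V p' ◁ delLeft V q' ≫
        mulUnsigned V p q p' (q' + 1) r (s + 1) hr (by omega)) := by
  rw [mulUnsigned_eq, Category.assoc, nestedMul_whiskerLeft V p p' r hr _ _ _ _ _ _ _
    (mulBExt_delLeft V q q' s hs), mulUnsigned_eq, mulUnsigned_eq,
    associator_naturality_right_assoc,
    associator_naturality_middle_assoc, Preadditive.comp_add, Preadditive.comp_zsmul]

lemma mulOmega_del (V : C) (p q p' q' r s : ℕ) (hr : p + p' = r) (hs : q + q' = s) :
    mulOmega V p q p' q' r s hr hs ≫ del V r s =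
      del V p q ▷ Omega V p' q' ≫ mulOmega V (p + 1) q p' q' (r + 1) s (by omega) hs +
        ((-1 : ℤ) ^ (p + q)) •
          (Omega V p q ◁ del V p' q' ≫ mulOmega V p q (p' + 1) q' (r + 1) s (by omega) hs) := by
  simp only [mulOmega_eq, del_eq, zsmul_whiskerRight, whiskerLeft_zsmul, Preadditive.zsmul_comp,
    Preadditive.comp_zsmul, smul_smul, mulUnsigned_extDel, smul_add]
  subst hr
  -- In the first term the unsigned factor $(-1)^{p'}$ cancels the $p'$ in $(-1)^{p+p'}$. In the
  -- second, raising $p'$ to $p'+1$ in $(-1)^{qp'}$ contributes the $(-1)^q$ that compensates the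
  -- one in $(-1)^{p+q}$.
  congr 2 <;> simp only [← pow_add] <;> refine neg_one_pow_congr ?_ <;> ring_nf <;> omega

lemma mulOmega_delBar (V : C) (p q p' q' r s : ℕ) (hr : p + p' = r) (hs : q + q' = s) :
    mulOmega V p q p' q' r s hr hs ≫ delBar V r s =
      delBar V p q ▷ Omega V p' q' ≫ mulOmega V p (q + 1) p' q' r (s + 1) hr (by omega) +
        ((-1 : ℤ) ^ (p + q)) •
          (Omega V p q ◁ delBar V p' q' ≫ mulOmega V p q p' (q' + 1) r (s + 1) hr (by omega)) := by
  simp only [mulOmega_eq, delBar, zsmul_whiskerRight, whiskerLeft_zsmul, Preadditive.zsmul_comp,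
    Preadditive.comp_zsmul, smul_smul, mulUnsigned_delLeft, smul_add]
  subst hr
  congr 2 <;> simp only [← pow_add] <;> refine neg_one_pow_congr ?_ <;> ring_nf

/-- By associativity of $\wedge$ the two extracted letters are first multiplied together in
$\Lambda^2$, where `leftDB_leftDB` with $Q=\wedge$ annihilates them. -/
lemma del_del (V : C) (p q : ℕ) : del V p q ≫ del V (p + 1) q = 0 := by
  have h : op12 (leftDB V) (Lam V q) ≫ V ◁ op12 (leftDB V) (Lam V q) ≫
      op21 (wedgeGen V) (B V ⊗ Lam V q) = 0 := by
    have := congrArg (fun f => f ▷ Lam V q ≫ (α_ _ _ _).hom)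
      (leftDB_leftDB V (wedgeGen V) (braiding_wedgeGen V))
    simp only [MonoidalPreadditive.zero_whiskerRight, zero_comp] at this
    rw [← this]
    simp only [op12, op21]; monoidal
  have h' : op21 (wedgeGenRight V p) (V ⊗ (B V ⊗ Lam V q)) ≫
      op21 (wedgeGenRight V (p + 1)) (B V ⊗ Lam V q) =
      Lam V p ◁ op21 (wedgeGen V) (B V ⊗ Lam V q) ≫
        op21 (wedge V p 2 (p + 2) rfl) (B V ⊗ Lam V q) := by
    rw [wedgeGen_eq, op21_whiskerRight_comp, wedgeGenRight, op21_whiskerLeft_comp, Category.assoc,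
      wedge_wedgeGenRight V _ p 1 (p + 1) rfl, whiskerLeft_comp, Category.assoc]
  rw [del_eq, del_eq, Preadditive.zsmul_comp, Preadditive.comp_zsmul, extDel, extDel,
    Category.assoc, reassoc_of% @op21_tail, h', ← whiskerLeft_comp_assoc, ← whiskerLeft_comp_assoc,
    Category.assoc, h]
  simp

lemma delBar_delBar (V : C) (p q : ℕ) : delBar V p q ≫ delBar V p (q + 1) = 0 := by
  have h : op12 (rightDB V) (Lam V q) ≫ op12 (rightDB V) (V ⊗ Lam V q) ≫
      B V ◁ op21 (wedgeGen V) (Lam V q) = 0 := by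
    have := congrArg (fun f => f ▷ Lam V q ≫ (α_ _ _ _).hom)
      (rightDB_rightDB V (wedgeGen V) (braiding_wedgeGen V))
    simp only [MonoidalPreadditive.zero_whiskerRight, zero_comp] at this
    rw [← this]
    simp only [op12, op21]; monoidal
  have h' : delLeft V q ≫ delLeft V (q + 1) = 0 := by
    rw [delLeft_eq, delLeft_eq, Category.assoc, ← reassoc_of% @op12_tail, ← whiskerLeft_comp,
      wedgeGenLeft_wedgeGenLeft, whiskerLeft_comp, reassoc_of% h, zero_comp]
  rw [delBar, delBar, Preadditive.zsmul_comp, Preadditive.comp_zsmul, ← whiskerLeft_comp, h']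
  simp

/-- Without signs the two differentials commute, as extracting a letter on the left of $b$ commutes
with extracting one on the right. The sign of $\bar\partial$ is $(-1)^{p+1}$ after $\partial$ but
$(-1)^p$ before it, so the sum cancels. -/
lemma del_delBar (V : C) (p q : ℕ) :
    del V p q ≫ delBar V (p + 1) q + delBar V p q ≫ del V p (q + 1) = 0 := by
  have h : op12 (leftDB V) (Lam V q) ≫ V ◁ delLeft V q =
      delLeft V q ≫ op12 (leftDB V) (Lam V (q + 1)) := by
    rw [delLeft_eq, whiskerLeft_comp, ← reassoc_of% (op12_coassoc (leftDB_rightDB V) (Lam V q)),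
      op12_tail, Category.assoc]
  have h' : extDel V p (op12 (leftDB V) (Lam V q)) ≫ Lam V (p + 1) ◁ delLeft V q =
      Lam V p ◁ delLeft V q ≫ extDel V p (op12 (leftDB V) (Lam V (q + 1))) := by
    rw [extDel, extDel, Category.assoc, op21_tail, ← whiskerLeft_comp_assoc, h,
      whiskerLeft_comp_assoc]
  simp only [del_eq, delBar, Preadditive.zsmul_comp, Preadditive.comp_zsmul, smul_smul, h']
  rw [← add_smul, pow_succ]
  simp

end DoubleComplex

end BraidedPlane

theorem proposition3p1 {C : Type*} [Category C] [Abelian C] [MonoidalCategory C]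
    [MonoidalPreadditive C] [BraidedCategory C] [HasCoproductsOfShape ℕ C]
    [∀ X : C, PreservesColimitsOfShape (Discrete ℕ) (tensorLeft X)]
    [∀ X : C, PreservesFiniteLimits (tensorLeft X)]
    [∀ X : C, PreservesFiniteColimits (tensorLeft X)] (V : C) :
    BraidedPlane.WellDefined V ∧
      BraidedPlane.IsDoubleComplex (BraidedPlane.Omega V) (BraidedPlane.unitOmega V)
        (BraidedPlane.mulOmega V) (BraidedPlane.del V) (BraidedPlane.delBar V) :=
  ⟨BraidedPlane.wellDefined V,
    { one_mul := BraidedPlane.unitOmega_mulOmega V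
      mul_one := BraidedPlane.mulOmega_unitOmega V
      mul_assoc := BraidedPlane.mulOmega_assoc V
      d_mul := BraidedPlane.mulOmega_del V
      dbar_mul := BraidedPlane.mulOmega_delBar V
      d_d := BraidedPlane.del_del V
      dbar_dbar := BraidedPlane.delBar_delBar V
      anticomm := BraidedPlane.del_delBar V }⟩
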